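/- An *undirected binary phylogenetic network* is a finite simple connected graph $N=(V,E)$ in which every vertex has degree $1$ (a leaf) or $3$, with at least two leaves. A *directed binary phylogenetic network* is a finite directed acyclic graph (without loops or multiple arcs), connected as an undirected graph, with exactly one vertex (the root) with (in-degree, out-degree) $=(0,2)$, all other vertices having (in-degree, out-degree) $(1,2)$ (tree vertex), $(2,1)$ (reticulation) or $(1,0)$ (leaf); it is *tree-child* if every non-leaf vertex has a child that is a tree vertex or a leaf. An *orientation* of $N$ with root edge $e_\rho\in E$ is a directed binary phylogenetic network obtained from $N$ by subdividing $e_\rho$ with a new vertex $\rho$, which becomes the root, and directing every edge. *Tree-Child Orientation* asks, given $N$, to output a tree-child orientation of $N$ if one exists (then $N$ is *tree-child orientable*), and "NO" otherwise. *Constrained Orientation* asks, given $N$, $e_\rho\in E$ and $\delta:V\to\mathbb N$, to output an orientation of $N$ with root edge $e_\rho$ in which every $v\in V$ has in-degree $\delta(v)$ if one exists, and "NO" otherwise. Let $r:=|E|-|V|+1$. A *cycle basis* of $N$ is a family of $r$ cycles of $N$ whose edge sets form a basis of the cycle space of $N$ over $\mathbb F_2$; it is *minimal* if its total length $\sum_i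 |E(C_i)|$ is minimum among all cycle bases. The *heuristic algorithm* does the following on input $N$. It computes some minimal cycle basis $C_1,\dots,C_r$, the set $S$ of all $(v_1,\dots,v_r)\in V(C_1)\times\dots\times V(C_r)$ with $d_N(v_i,v_j)\ge 2$ for $i<j$, and the set $S^*$ of those $s\in S$ that maximise $f(s)=\sum_{i<j}d_N(v_i,v_j)$ over $S$. For each $s\in S^*$ (in any order) it puts $\delta(v)=2$ if $v$ is an entry of $s$ and $\delta(v)=1$ otherwise, and for each $e_\rho\in E$ (in any order) it solves Constrained Orientation for $(N,e_\rho,\delta)$; as soon as this yields an orientation in which no vertex has children all of which are reticulations, the algorithm returns this orientation. If this never happens, it returns "NO". **Theorem.** Let $N=(V,E)$ be an undirected binary phylogenetic network with $r=|E|-|V|+1\le 2$. Then the heuristic algorithm returns a correct solution to Tree-Child Orientation on input $N$: it has a run on $N$, and, whatever minimal cycle basis and whatever orders are used, every run returns a tree-child orientation of $N$ if one exists, and "NO" otherwise. Moreover, if $C_1$ and $C_2$ are cycles of $N$ that share exactly one edge, then $N$ is tree-child orientable if and only if at least one of $C_1$, $C_2$ has length at least $4$. -/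

import Mathlib

namespace PhyloOrientation

/-! ### Undirected binary phylogenetic networks -/

/-- An undirected binary phylogenetic network: a finite simple connected graph all of whose vertices
have degree 1 (the leaves, which form the set `X`) or 3, with at least two leaves. -/
structure IsUndirectedBinaryNetwork {V : Type*} [Fintype V] (N : SimpleGraph V) : Prop where
  connected : N.Connected
  degrees : ∀ v, (N.neighborSet v).ncard = 1 ∨ (N.neighborSet v).ncard = 3
  two_le_leaves : 2 ≤ {v | (N.neighborSet v).ncard = 1}.ncard

/-- The cycle rank `|E| - |V| + 1`. For a connected graph `|V| ≤ |E| + 1`, so the subtraction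
does not truncate. -/
noncomputable def cycleRank {V : Type*} [Fintype V] (N : SimpleGraph V) : ℕ :=
  N.edgeSet.ncard + 1 - Fintype.card V

/-! ### Directed binary phylogenetic networks -/

noncomputable def indeg {W : Type*} (D : Digraph W) (v : W) : ℕ := {u | D.Adj u v}.ncard

noncomputable def outdeg {W : Type*} (D : Digraph W) (v : W) : ℕ := {w | D.Adj v w}.ncard

def IsRoot {W : Type*} (D : Digraph W) (v : W) : Prop := indeg D v = 0 ∧ outdeg D v = 2

def IsTreeVertex {W : Type*} (D : Digraph W) (v : W) : Prop := indeg D v = 1 ∧ outdeg D v = 2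

def IsReticulation {W : Type*} (D : Digraph W) (v : W) : Prop := indeg D v = 2 ∧ outdeg D v = 1

def IsLeaf {W : Type*} (D : Digraph W) (v : W) : Prop := indeg D v = 1 ∧ outdeg D v = 0

/-- No directed cycle (in particular no loop and no pair of opposite arcs). -/
def IsAcyclic {W : Type*} (D : Digraph W) : Prop := ∀ v, ¬ Relation.TransGen D.Adj v v

/-- The underlying graph. -/
def underlying {W : Type*} (D : Digraph W) : SimpleGraph W := SimpleGraph.fromRel D.Adj

structure IsDirectedBinaryNetwork {W : Type*} [Fintype W] (D : Digraph W) : Prop where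
  acyclic : IsAcyclic D
  connected : (underlying D).Connected
  exists_unique_root : ∃! ρ, IsRoot D ρ
  vertex_types : ∀ v, IsRoot D v ∨ IsTreeVertex D v ∨ IsReticulation D v ∨ IsLeaf D v

/-- Every non-leaf vertex has a child that is a tree vertex or a leaf. -/
def IsTreeChild {W : Type*} (D : Digraph W) : Prop :=
  ∀ v, ¬ IsLeaf D v → ∃ w, D.Adj v w ∧ (IsTreeVertex D w ∨ IsLeaf D w)

/-! ### Orientations

The vertex set of an orientation of a network on `V` is `Option V`, where `none` is the root that is
inserted into an edge. -/

/-- The graph obtained from `N` by subdividing the edge `e` with the new vertex `none`. -/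
def insertRoot {V : Type*} (N : SimpleGraph V) (e : Sym2 V) : SimpleGraph (Option V) :=
  SimpleGraph.fromRel fun
    | some a, some b => N.Adj a b ∧ s(a, b) ≠ e
    | none, some a => a ∈ e
    | _, none => False

/-- `D` is an orientation of `N` whose root is inserted into the edge `e`. -/
def IsOrientationAt {V : Type*} [Fintype V] (N : SimpleGraph V) (e : Sym2 V)
    (D : Digraph (Option V)) : Prop :=
  e ∈ N.edgeSet ∧ IsDirectedBinaryNetwork D ∧ IsRoot D none ∧ underlying D = insertRoot N e

/-- `D` is an orientation of `N` that is a tree-child network. -/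
def IsTreeChildOrientation {V : Type*} [Fintype V] (N : SimpleGraph V)
    (D : Digraph (Option V)) : Prop :=
  (∃ e, IsOrientationAt N e D) ∧ IsTreeChild D

def IsTreeChildOrientable {V : Type*} [Fintype V] (N : SimpleGraph V) : Prop :=
  ∃ D, IsTreeChildOrientation N D

/-- The correct answers to Tree-Child Orientation; `none` is the answer "NO". -/
def IsTreeChildAnswer {V : Type*} [Fintype V] (N : SimpleGraph V) :
    Option (Digraph (Option V)) → Prop
  | some D => IsTreeChildOrientation N D
  | none => ¬ IsTreeChildOrientable N

/-- `D` is an orientation of `N` with root edge `e` and in-degrees `δ`. -/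
def SatisfiesConstraint {V : Type*} [Fintype V] (N : SimpleGraph V) (e : Sym2 V) (δ : V → ℕ)
    (D : Digraph (Option V)) : Prop :=
  IsOrientationAt N e D ∧ ∀ v, indeg D (some v) = δ v

/-- The correct answers to Constrained Orientation; `none` is the answer "NO". -/
def IsConstrainedAnswer {V : Type*} [Fintype V] (N : SimpleGraph V) (e : Sym2 V) (δ : V → ℕ) :
    Option (Digraph (Option V)) → Prop
  | some D => SatisfiesConstraint N e δ D
  | none => ¬ ∃ D, SatisfiesConstraint N e δ D

/-! ### Cycle bases -/

/-- The subgraph `C` is a cycle of `N`. -/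
def IsCycleOf {V : Type*} (N : SimpleGraph V) (C : N.Subgraph) : Prop :=
  ∃ (v : V) (p : N.Walk v v), p.IsCycle ∧ p.toSubgraph = C

/-- The number of edges. -/
noncomputable def length {V : Type*} {N : SimpleGraph V} (C : N.Subgraph) : ℕ := C.edgeSet.ncard

/-- The cycle space over `𝔽₂`: edge sets of even-degree subgraphs of `N`. -/
def cycleSpace {V : Type*} [Fintype V] (N : SimpleGraph V) :
    Submodule (ZMod 2) (Sym2 V → ZMod 2) where
  carrier := {x | (∀ e, e ∉ N.edgeSet → x e = 0) ∧ ∀ v, ∑ w, x s(v, w) = 0}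
  zero_mem' := by simp
  add_mem' := by
    rintro x y ⟨hx, hx'⟩ ⟨hy, hy'⟩
    refine ⟨fun e he => ?_, fun v => ?_⟩
    · simp [hx e he, hy e he]
    · simp [Finset.sum_add_distrib, hx' v, hy' v]
  smul_mem' := by
    rintro c x ⟨hx, hx'⟩
    refine ⟨fun e he => ?_, fun v => ?_⟩
    · simp [hx e he]
    · simp [← Finset.mul_sum, hx' v]

/-- The edge set of a subgraph as a vector over `𝔽₂`. -/
noncomputable def edgeVector {V : Type*} {N : SimpleGraph V} (C : N.Subgraph) :
    Sym2 V → ZMod 2 :=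
  C.edgeSet.indicator 1

structure IsCycleBasis {V : Type*} [Fintype V] {N : SimpleGraph V} {n : ℕ}
    (C : Fin n → N.Subgraph) : Prop where
  isCycle : ∀ i, IsCycleOf N (C i)
  linearIndependent : LinearIndependent (ZMod 2) fun i => edgeVector (C i)
  span_eq : Submodule.span (ZMod 2) (Set.range fun i => edgeVector (C i)) = cycleSpace N

/-- A cycle basis of minimum total length (all cycle bases of `N` have the same size). -/
def IsMinimalCycleBasis {V : Type*} [Fintype V] {N : SimpleGraph V} {n : ℕ}
    (C : Fin n → N.Subgraph) : Prop :=
  IsCycleBasis C ∧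
    ∀ C' : Fin n → N.Subgraph, IsCycleBasis C' → ∑ i, length (C i) ≤ ∑ i, length (C' i)

/-! ### The heuristic algorithm -/

/-- The set `S` of placements: one vertex from each basic cycle, pairwise at distance at least 2. -/
def placements {V : Type*} {N : SimpleGraph V} {n : ℕ} (C : Fin n → N.Subgraph) :
    Set (Fin n → V) :=
  {s | (∀ i, s i ∈ (C i).verts) ∧ ∀ i j, i < j → 2 ≤ N.dist (s i) (s j)}

/-- The objective function `f`: the sum of the pairwise distances. -/
noncomputable def distanceSum {V : Type*} (N : SimpleGraph V) {n : ℕ} (s : Fin n → V) : ℕ :=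
  ∑ i, ∑ j ∈ Finset.Ioi i, N.dist (s i) (s j)

/-- The set `S*` of placements that maximise `f` over `S`. -/
def optimalPlacements {V : Type*} {N : SimpleGraph V} {n : ℕ} (C : Fin n → N.Subgraph) :
    Set (Fin n → V) :=
  {s | s ∈ placements C ∧ ∀ t ∈ placements C, distanceSum N t ≤ distanceSum N s}

open Classical in
/-- The desired in-degrees for a placement. -/
noncomputable def desiredIndeg {V : Type*} {n : ℕ} (s : Fin n → V) (v : V) : ℕ :=
  if v ∈ Set.range s then 2 else 1

/-- The acceptance test: no vertex (that has children) has only reticulations as its children. -/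
def PassesTest {W : Type*} (D : Digraph W) : Prop :=
  ¬ ∃ v, (∃ w, D.Adj v w) ∧ ∀ w, D.Adj v w → IsReticulation D w

open Classical in
/-- The inner loop over root edges. Here `solve e` is the answer of the subroutine for
Constrained Orientation with root edge `e` and the current desired in-degrees. -/
noncomputable def edgeLoop {V : Type*} (solve : Sym2 V → Option (Digraph (Option V))) :
    List (Sym2 V) → Option (Digraph (Option V))
  | [] => none
  | e :: es =>
    match solve e with
    | some D => if PassesTest D then some D else edgeLoop solve es
    | none => edgeLoop solve es

/-- The outer loop over reticulation placements; `order s` is the order in which the root edges are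
tried for the placement `s`. -/
noncomputable def placementLoop {V : Type*} {n : ℕ}
    (solve : Sym2 V → (V → ℕ) → Option (Digraph (Option V)))
    (order : (Fin n → V) → List (Sym2 V)) : List (Fin n → V) → Option (Digraph (Option V))
  | [] => none
  | s :: ss =>
    match edgeLoop (fun e => solve e (desiredIndeg s)) (order s) with
    | some D => some D
    | none => placementLoop solve order ss

/-- `o` is the output of some run of the heuristic algorithm on `N`. The algorithm leaves open
which minimal cycle basis `C` is computed, in which order `ss` the elements of `S*` are processed,
in which order the root edges are picked, and by which means an instance of Constrained Orientation
is solved. -/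
def HeuristicReturns {V : Type*} [Fintype V] (N : SimpleGraph V)
    (o : Option (Digraph (Option V))) : Prop :=
  ∃ (C : Fin (cycleRank N) → N.Subgraph) (ss : List (Fin (cycleRank N) → V))
    (order : (Fin (cycleRank N) → V) → List (Sym2 V))
    (solve : Sym2 V → (V → ℕ) → Option (Digraph (Option V))),
    IsMinimalCycleBasis C ∧
    (ss.Nodup ∧ ∀ s, s ∈ ss ↔ s ∈ optimalPlacements C) ∧
    (∀ s, (order s).Nodup ∧ ∀ e, e ∈ order s ↔ e ∈ N.edgeSet) ∧
    (∀ e ∈ N.edgeSet, ∀ δ, IsConstrainedAnswer N e δ (solve e δ)) ∧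
    o = placementLoop solve order ss

end PhyloOrientation

namespace PhyloOrientation

open SimpleGraph

/-! ### Vectors of walks -/

section CycleSpace

variable {V : Type*} {N : SimpleGraph V}

/-! Counting in-degrees shows that an orientation has exactly r reticulations. Every nonzero vector
of the cycle space has a sink in an orientation, and that sink is a reticulation
(`IsOrientationAt.exists_sink`). For r ≤ 2 it follows that the reticulations are distinct
representatives of the cycles of any cycle basis. In a tree-child orientation they are also pairwise
non-adjacent, so they form a placement s in S.

If s is optimal, the algorithm finds the orientation, because a root edge and in-degrees determine
an orientation uniquely (`SatisfiesConstraint.unique`). Otherwise r = 2 and the optimal distance is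
at least 3. Every constrained orientation of an optimal placement then passes the test, since
adjacent reticulations or a common parent would force distance at most 2. What remains is that some
optimal placement has a constrained orientation at all
(`exists_optimalPlacement_satisfiesConstraint`).

For existence, the vertices are ordered greedily from the root. This can only get stuck at a set B
that too few edges enter (`IsObstruction`). A cycle meets the boundary of B in an even number of
edges, so a cycle that crosses it contains both chosen vertices. If the basic cycles share an edge,
that edge serves as root edge, and obstructions are excluded unless both chosen vertices lie on both
cycles. In that case minimality of the basis yields another optimal placement with an entry outside
one of the cycles: some edge of a basic cycle, closed up by shortest paths from an arbitrary vertex,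
could replace that cycle, so the cycle has a vertex far from the given one. If the cycles are
disjoint, the root is put on the first one, and maximality of the distance excludes obstructions.

For cycles sharing exactly one edge pq, the cycle space has only four vectors. If one cycle has
length at least 4, rooting at pq with reticulations at p and at a neighbour of q on the long cycle
works. For two triangles, the reticulations must be the two apexes, and p or q is a parent of both.
-/

theorem zmod_two_eq_one {a : ZMod 2} (h : a ≠ 0) : a = 1 := by
  revert h; revert a; decide

open Classical in
/-- The multiset of edges of a walk as a vector over `𝔽₂`. -/
noncomputable def walkVector {u v : V} (p : N.Walk u v) : Sym2 V → ZMod 2 :=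
  fun e => (p.edges.count e : ZMod 2)

theorem walkVector_ne_zero {u v : V} {p : N.Walk u v} {e : Sym2 V} (h : walkVector p e ≠ 0) :
    e ∈ p.edges := by
  classical
  by_contra hc
  exact h (by simp [walkVector, List.count_eq_zero_of_not_mem hc])

theorem walkVector_nil (u : V) : walkVector (Walk.nil : N.Walk u u) = 0 := by
  funext e; simp [walkVector]

open Classical in
theorem walkVector_cons {u v w : V} (h : N.Adj u v) (p : N.Walk v w) :
    walkVector (Walk.cons h p) = Pi.single s(u, v) 1 + walkVector p := by
  funext e
  by_cases he : e = s(u, v)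
  · subst he; simp [walkVector, add_comm]
  · have : s(u, v) ≠ e := fun h => he h.symm
    simp [walkVector, he, this]

theorem walkVector_append {u v w : V} (p : N.Walk u v) (q : N.Walk v w) :
    walkVector (p.append q) = walkVector p + walkVector q := by
  funext e; simp [walkVector]

theorem walkVector_reverse {u v : V} (p : N.Walk u v) :
    walkVector p.reverse = walkVector p := by
  funext e; simp [walkVector, List.count_reverse]

theorem edgeVector_apply_of_mem {C : N.Subgraph} {e : Sym2 V} (h : e ∈ C.edgeSet) :
    edgeVector C e = 1 := by simp [edgeVector, h]

theorem edgeVector_ne_zero_iff {C : N.Subgraph} {e : Sym2 V} :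
    edgeVector C e ≠ 0 ↔ e ∈ C.edgeSet := by
  simp [edgeVector]

theorem support_edgeVector (C : N.Subgraph) : Function.support (edgeVector C) = C.edgeSet := by
  ext e; exact edgeVector_ne_zero_iff

/-- A trail repeats no edge, so its edge multiplicities are 0 or 1. -/
theorem walkVector_eq_edgeVector {u v : V} {p : N.Walk u v} (hp : p.IsTrail) :
    walkVector p = edgeVector p.toSubgraph := by
  classical
  funext e
  by_cases he : e ∈ p.edges
  · rw [edgeVector_apply_of_mem (p.mem_edges_toSubgraph.2 he)]
    simp [walkVector, List.count_eq_one_of_mem hp.edges_nodup he]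
  · have : edgeVector p.toSubgraph e = 0 := by
      by_contra hc
      exact he (p.mem_edges_toSubgraph.1 (edgeVector_ne_zero_iff.1 hc))
    rw [this]
    by_contra hc
    exact he (walkVector_ne_zero hc)

theorem IsCycleOf.edgeSet_nonempty {C : N.Subgraph} (hC : IsCycleOf N C) : C.edgeSet.Nonempty := by
  obtain ⟨v, p, hp, rfl⟩ := hC
  have h := hp.three_le_length
  rw [← p.length_edges] at h
  obtain ⟨e, he⟩ := List.exists_mem_of_length_pos (by omega : 0 < p.edges.length)
  exact ⟨e, p.mem_edges_toSubgraph.2 he⟩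

theorem IsCycleOf.edgeVector_ne_zero {C : N.Subgraph} (hC : IsCycleOf N C) : edgeVector C ≠ 0 := by
  obtain ⟨e, he⟩ := hC.edgeSet_nonempty
  exact fun h => edgeVector_ne_zero_iff.2 he (congrFun h e)

/-- Extension by zero of an edge labelling. -/
noncomputable def extendEdges (N : SimpleGraph V) :
    (N.edgeSet → ZMod 2) →ₗ[ZMod 2] (Sym2 V → ZMod 2) :=
  Function.ExtendByZero.linearMap (ZMod 2) (Subtype.val : N.edgeSet → Sym2 V)

theorem extendEdges_apply (f : N.edgeSet → ZMod 2) (e : N.edgeSet) : extendEdges N f e = f e :=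
  Subtype.val_injective.extend_apply f 0 e

theorem extendEdges_apply_notMem (f : N.edgeSet → ZMod 2) {e : Sym2 V} (he : e ∉ N.edgeSet) :
    extendEdges N f e = 0 :=
  Function.extend_apply' (f := (Subtype.val : N.edgeSet → Sym2 V)) f 0 e
    (by rintro ⟨a, rfl⟩; exact he a.2)

theorem extendEdges_injective (N : SimpleGraph V) : Function.Injective (extendEdges N) := by
  intro f g h
  funext e
  rw [← extendEdges_apply f, ← extendEdges_apply g, h]

variable [Fintype V]

/-! ### Even degrees: closed walks, cuts, and cycles inside cycle-space vectors. -/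

open Classical in
theorem sum_single_edge {a b : V} (h : a ≠ b) (x : V) :
    ∑ w, (Pi.single s(a, b) 1 : Sym2 V → ZMod 2) s(x, w) =
      (if x = a then 1 else 0) + (if x = b then 1 else 0) := by
  by_cases ha : x = a
  · subst ha
    rw [Finset.sum_eq_single b] <;> simp [h, Pi.single_apply]
  · by_cases hb : x = b
    · subst hb
      rw [Finset.sum_eq_single a] <;> simp [h, Pi.single_apply, ha]
    · simp [ha, hb]

-- Modulo 2 the boundary of a walk consists of its two ends, which cancel for a closed walk.
open Classical in
theorem sum_walkVector {u v : V} (p : N.Walk u v) (x : V) :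
    ∑ w, walkVector p s(x, w) = (if x = u then 1 else 0) + (if x = v then 1 else 0) := by
  induction p with
  | nil => simp [walkVector_nil, CharTwo.add_self_eq_zero]
  | @cons u v w h p ih =>
    simp only [walkVector_cons, Pi.add_apply, Finset.sum_add_distrib, ih, sum_single_edge h.ne]
    have := CharTwo.add_self_eq_zero (if x = v then 1 else 0 : ZMod 2)
    linear_combination this

theorem walkVector_mem_cycleSpace {u : V} (p : N.Walk u u) : walkVector p ∈ cycleSpace N := by
  classical
  refine ⟨fun e he => ?_, fun v => ?_⟩
  · by_contra hc
    exact he (p.edges_subset_edgeSet (walkVector_ne_zero hc))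
  · rw [sum_walkVector, CharTwo.add_self_eq_zero]

theorem IsCycleOf.mem_cycleSpace {C : N.Subgraph} (hC : IsCycleOf N C) :
    edgeVector C ∈ cycleSpace N := by
  obtain ⟨v, p, hp, rfl⟩ := hC
  rw [← walkVector_eq_edgeVector hp.isTrail]
  exact walkVector_mem_cycleSpace p

theorem cycleSpace_apply_ne_zero {z : Sym2 V → ZMod 2} (hz : z ∈ cycleSpace N) {v w : V}
    (h : z s(v, w) ≠ 0) : N.Adj v w := by
  by_contra hc
  exact h (hz.1 _ hc)

/-- A vector of the cycle space meets every cut evenly. -/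
theorem cycleSpace_sum_cut {z : Sym2 V → ZMod 2} (hz : z ∈ cycleSpace N) (B : Finset V)
    [DecidableEq V] : ∑ v ∈ B, ∑ w ∈ Bᶜ, z s(v, w) = 0 := by
  have h1 : ∑ v ∈ B, ∑ w, z s(v, w) = 0 := Finset.sum_eq_zero fun v _ => hz.2 v
  have h2 : ∑ v ∈ B, ∑ w ∈ B, z s(v, w) = 0 := by
    rw [← Finset.sum_product']
    -- An edge inside B is counted once from each end; a pair fixed by the swap would be a loop.
    refine Finset.sum_involution (fun a _ => a.swap) ?_ ?_ ?_ ?_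
    · rintro ⟨a, b⟩ _
      simp [Sym2.eq_swap (a := b), CharTwo.add_self_eq_zero]
    · rintro ⟨a, b⟩ _ h hs
      have := cycleSpace_apply_ne_zero hz h
      simp at hs
      exact this.ne hs.2
    · rintro ⟨a, b⟩ h; simpa [and_comm] using h
    · rintro ⟨a, b⟩ _; rfl
  have h3 : ∀ v, ∑ w, z s(v, w) = ∑ w ∈ B, z s(v, w) + ∑ w ∈ Bᶜ, z s(v, w) :=
    fun v => (Finset.sum_add_sum_compl B _).symm
  simp only [h3, Finset.sum_add_distrib, h2, zero_add] at h1
  exact h1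

/-- If a vector of the cycle space has an edge across a cut, it has a second one. -/
theorem cycleSpace_exists_second_cut_edge {z : Sym2 V → ZMod 2} (hz : z ∈ cycleSpace N)
    {B : Set V} {v w : V} (hv : v ∈ B) (hw : w ∉ B) (h : z s(v, w) ≠ 0) :
    ∃ v' ∈ B, ∃ w' ∉ B, z s(v', w') ≠ 0 ∧ (v', w') ≠ (v, w) := by
  classical
  -- Otherwise the sum over the cut collapses to the single nonzero term of vw.
  by_contra! hc
  have hs := cycleSpace_sum_cut hz B.toFinset
  rw [Finset.sum_eq_single v, Finset.sum_eq_single w] at hs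
  · exact h hs
  · intro b hb hne
    by_contra h0
    exact hne (congrArg Prod.snd (hc v hv b (by simpa using hb) h0))
  · intro hb; simp [hw] at hb
  · intro b hb hne
    refine Finset.sum_eq_zero fun c hcm => ?_
    by_contra h0
    exact hne (congrArg Prod.fst (hc b (by simpa using hb) c (by simpa using hcm) h0))
  · intro hb; simp [hv] at hb

/-- A nonzero vector of the cycle space contains a cycle. -/
theorem exists_isCycleOf_subset_support {z : Sym2 V → ZMod 2} (hz : z ∈ cycleSpace N) (h0 : z ≠ 0) :
    ∃ C : N.Subgraph, IsCycleOf N C ∧ C.edgeSet ⊆ Function.support z := by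
  classical
  obtain ⟨e, he⟩ := Function.ne_iff.1 h0
  let H : SimpleGraph V := SimpleGraph.fromEdgeSet (Function.support z)
  have hadj : ∀ a b, H.Adj a b ↔ z s(a, b) ≠ 0 := by
    intro a b
    simp only [H, fromEdgeSet_adj, Function.mem_support]
    exact ⟨fun h => h.1, fun h => ⟨h, (cycleSpace_apply_ne_zero hz h).ne⟩⟩
  have hle : H ≤ N := fun a b h => cycleSpace_apply_ne_zero hz ((hadj a b).1 h)
  induction e with | h u v
  have huv : H.Adj u v := (hadj u v).2 he
  -- A bridge uv would be the only edge of z across the cut given by the component of u after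
  -- deleting uv, against evenness.
  have hnb : ¬ H.IsBridge s(u, v) := by
    intro hb
    rw [isBridge_iff] at hb
    obtain ⟨v', hv', w', hw', hzz, hne⟩ := cycleSpace_exists_second_cut_edge hz
      (B := {x | (H.deleteEdges {s(u, v)}).Reachable u x}) (v := u) (w := v)
      (Reachable.refl u) hb he
    refine hw' (Reachable.trans hv' (Adj.reachable ?_))
    rw [deleteEdges_adj]
    refine ⟨(hadj _ _).2 hzz, fun hmem => ?_⟩
    rcases Sym2.eq_iff.1 (Set.mem_singleton_iff.1 hmem) with ⟨rfl, rfl⟩ | ⟨rfl, rfl⟩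
    · exact hne rfl
    · exact hb hv'
  rw [isBridge_iff_forall_cycle_notMem huv] at hnb
  push Not at hnb
  obtain ⟨x, p, hp, -⟩ := hnb
  refine ⟨(p.mapLe hle).toSubgraph, ⟨x, p.mapLe hle, (Walk.isCycle_mapLe hle).2 hp, rfl⟩, ?_⟩
  intro f hf
  rw [Walk.mem_edges_toSubgraph, Walk.edges_mapLe_eq_edges] at hf
  have := p.edges_subset_edgeSet hf
  induction f with | h a b
  exact (hadj a b).1 this

/-- A vector of the cycle space outside of a subspace contains a cycle outside of the subspace. -/
theorem exists_isCycleOf_notMem (P : Submodule (ZMod 2) (Sym2 V → ZMod 2)) :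
    ∀ z ∈ cycleSpace N, z ∉ P →
      ∃ C : N.Subgraph, IsCycleOf N C ∧ C.edgeSet ⊆ Function.support z ∧ edgeVector C ∉ P := by
  suffices H : ∀ (n : ℕ), ∀ z ∈ cycleSpace N, (Function.support z).ncard = n → z ∉ P →
      ∃ C : N.Subgraph, IsCycleOf N C ∧ C.edgeSet ⊆ Function.support z ∧ edgeVector C ∉ P from
    fun z hz => H _ z hz rfl
  intro n
  induction n using Nat.strong_induction_on with
  | _ n ih =>
    intro z hz hn hP
    obtain ⟨C, hC, hsub⟩ := exists_isCycleOf_subset_support hz fun h => hP (h ▸ P.zero_mem)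
    by_cases hCP : edgeVector C ∈ P
    -- Adding a cycle that lies in P and in the support of z removes its edges from the support and
    -- keeps the vector outside P.
    · have hss : Function.support (z + edgeVector C) ⊂ Function.support z := by
        refine ⟨fun e he => ?_, fun h => ?_⟩
        · by_contra hc
          have h1 : z e = 0 := by simpa using hc
          have h2 : e ∉ C.edgeSet := fun h => hc (hsub h)
          refine he ?_
          have h3 : edgeVector C e = 0 := by
            by_contra h; exact h2 (edgeVector_ne_zero_iff.1 h)
          simp [h1, h3]
        · obtain ⟨e, he⟩ := hC.edgeSet_nonempty
          refine h (hsub he) ?_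
          rw [Pi.add_apply, zmod_two_eq_one (hsub he), edgeVector_apply_of_mem he]
          decide
      obtain ⟨C', hC', hsub', hn'⟩ := ih _ (hn ▸ Set.ncard_lt_ncard hss (Set.toFinite _))
        (z + edgeVector C) ((cycleSpace N).add_mem hz hC.mem_cycleSpace) rfl
        (fun h => hP ((P.add_mem_iff_left hCP).1 h))
      exact ⟨C', hC', hsub'.trans hss.1, hn'⟩
    · exact ⟨C, hC, hsub, hCP⟩

theorem span_cycles_eq_cycleSpace (N : SimpleGraph V) :
    Submodule.span (ZMod 2) {x | ∃ C : N.Subgraph, IsCycleOf N C ∧ edgeVector C = x} =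
      cycleSpace N := by
  apply le_antisymm
  · rw [Submodule.span_le]
    rintro x ⟨C, hC, rfl⟩
    exact hC.mem_cycleSpace
  · intro z hz
    by_contra hc
    obtain ⟨C, hC, -, hn⟩ := exists_isCycleOf_notMem _ z hz hc
    exact hn (Submodule.subset_span ⟨C, hC, rfl⟩)

/-! ### The dimension of the cycle space -/

/-- The boundary map of the graph. -/
noncomputable def boundary (N : SimpleGraph V) :
    (N.edgeSet → ZMod 2) →ₗ[ZMod 2] (V → ZMod 2) :=
  (LinearMap.pi fun v => ∑ w, LinearMap.proj s(v, w)) ∘ₗ extendEdges N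

theorem boundary_apply (f : N.edgeSet → ZMod 2) (v : V) :
    boundary N f v = ∑ w, extendEdges N f s(v, w) := by
  simp [boundary]

/-- Identifies the cycle space with the kernel of the boundary map, so that rank–nullity computes
its dimension. -/
theorem map_ker_boundary (N : SimpleGraph V) :
    (LinearMap.ker (boundary N)).map (extendEdges N) = cycleSpace N := by
  ext z
  constructor
  · rintro ⟨f, hf, rfl⟩
    refine ⟨fun e he => extendEdges_apply_notMem f he, fun v => ?_⟩
    rw [← boundary_apply, LinearMap.mem_ker.1 hf]; rfl
  · intro hz
    have hext : extendEdges N (fun e => z e) = z := by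
      funext e
      by_cases he : e ∈ N.edgeSet
      · exact extendEdges_apply _ ⟨e, he⟩
      · rw [extendEdges_apply_notMem _ he, hz.1 e he]
    refine ⟨fun e => z e, ?_, hext⟩
    rw [SetLike.mem_coe, LinearMap.mem_ker]
    funext v
    rw [boundary_apply, hext]; exact hz.2 v

open Classical in
theorem boundary_walk {u v : V} (p : N.Walk u v) :
    (Pi.single u 1 + Pi.single v 1 : V → ZMod 2) ∈ LinearMap.range (boundary N) := by
  have hext : extendEdges N (fun e => walkVector p e) = walkVector p := by
    funext e
    by_cases he : e ∈ N.edgeSet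
    · exact extendEdges_apply _ ⟨e, he⟩
    · rw [extendEdges_apply_notMem _ he]
      by_contra hc
      exact he (p.edges_subset_edgeSet (walkVector_ne_zero fun h => hc h.symm))
  refine ⟨fun e => walkVector p e, ?_⟩
  funext x
  rw [boundary_apply, hext, sum_walkVector]
  simp [Pi.single_apply]

/-- The range lies in the proper subspace of vectors with coordinate sum 0. A walk from v to v₀ puts
e_v + e_{v₀} into the range, so adjoining e_{v₀} already yields the whole space. -/
theorem finrank_range_boundary (hN : N.Connected) :
    Module.finrank (ZMod 2) (LinearMap.range (boundary N)) + 1 = Fintype.card V := by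
  classical
  obtain ⟨v₀⟩ := hN.nonempty
  apply le_antisymm
  · let σ : (V → ZMod 2) →ₗ[ZMod 2] ZMod 2 := ∑ v, LinearMap.proj v
    have hle : LinearMap.range (boundary N) ≤ LinearMap.ker σ := by
      rintro _ ⟨f, rfl⟩
      have hsum := Finset.sum_involution (s := (Finset.univ : Finset (V × V)))
        (f := fun a => extendEdges N f s(a.1, a.2)) (fun a _ => a.swap)
        (by rintro ⟨a, b⟩ _; simp [Sym2.eq_swap (a := b), CharTwo.add_self_eq_zero])
        (by
          rintro ⟨a, b⟩ _ h hs
          simp only [Prod.swap_prod_mk, Prod.mk.injEq] at hs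
          obtain rfl := hs.2
          exact h (extendEdges_apply_notMem f (by simp)))
        (by simp) (by simp)
      rw [LinearMap.mem_ker]
      simp only [σ, LinearMap.sum_apply, LinearMap.proj_apply, boundary_apply]
      rw [← Finset.univ_product_univ, Finset.sum_product] at hsum
      exact hsum
    have hlt : LinearMap.ker σ < ⊤ := by
      rw [lt_top_iff_ne_top]
      intro h
      have : (Pi.single v₀ 1 : V → ZMod 2) ∈ LinearMap.ker σ := h ▸ Submodule.mem_top
      rw [LinearMap.mem_ker] at this
      simp [σ, Pi.single_apply] at this
    have := Submodule.finrank_lt_finrank_of_lt (lt_of_le_of_lt hle hlt)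
    rw [finrank_top, Module.finrank_fintype_fun_eq_card] at this
    exact this
  · have htop : LinearMap.range (boundary N) ⊔ Submodule.span (ZMod 2) {Pi.single v₀ 1} = ⊤ := by
      rw [eq_top_iff]
      intro x _
      rw [pi_eq_sum_univ' x]
      refine Submodule.sum_mem _ fun v _ => Submodule.smul_mem _ _ ?_
      obtain ⟨p⟩ := hN.preconnected v v₀
      have h1 := Submodule.mem_sup_left (T := Submodule.span (ZMod 2) {Pi.single v₀ 1})
        (boundary_walk p)
      have h2 := Submodule.mem_sup_right (S := LinearMap.range (boundary N))
        (Submodule.mem_span_singleton_self (R := ZMod 2) (Pi.single v₀ 1 : V → ZMod 2))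
      have h3 := Submodule.add_mem _ h1 h2
      rw [add_assoc, show (Pi.single v₀ 1 + Pi.single v₀ 1 : V → ZMod 2) = 0 from
        funext fun _ => CharTwo.add_self_eq_zero _, add_zero] at h3
      convert h3 using 1
    have h1 := Submodule.finrank_add_le_finrank_add_finrank (LinearMap.range (boundary N))
      (Submodule.span (ZMod 2) {(Pi.single v₀ 1 : V → ZMod 2)})
    rw [htop, finrank_top, Module.finrank_fintype_fun_eq_card] at h1
    have h2 := finrank_span_le_card (R := ZMod 2) ({(Pi.single v₀ 1 : V → ZMod 2)} : Set _)
    simp at h2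
    omega

theorem finrank_cycleSpace (hN : N.Connected) :
    Module.finrank (ZMod 2) (cycleSpace N) = cycleRank N := by
  classical
  have h1 := LinearMap.finrank_range_add_finrank_ker (boundary N)
  have h2 := finrank_range_boundary hN
  have h3 : Module.finrank (ZMod 2) (cycleSpace N) =
      Module.finrank (ZMod 2) (LinearMap.ker (boundary N)) := by
    rw [← map_ker_boundary N]
    exact (LinearEquiv.finrank_eq
      (Submodule.equivMapOfInjective _ (extendEdges_injective N) _)).symm
  rw [Module.finrank_fintype_fun_eq_card] at h1
  have h4 : N.edgeSet.ncard = Fintype.card N.edgeSet := by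
    rw [← Nat.card_coe_set_eq, Nat.card_eq_fintype_card]
  rw [cycleRank, h3, h4]
  omega

/-! ### Cycle bases -/

theorem exists_isCycleBasis (hN : N.Connected) :
    ∃ C : Fin (cycleRank N) → N.Subgraph, IsCycleBasis C := by
  obtain ⟨f, hf, hspan, hli⟩ : ∃ f : Fin (cycleRank N) → Sym2 V → ZMod 2,
      (∀ i, f i ∈ {x | ∃ C : N.Subgraph, IsCycleOf N C ∧ edgeVector C = x}) ∧
      Submodule.span (ZMod 2) (Set.range f) = cycleSpace N ∧ LinearIndependent (ZMod 2) f := by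
    rw [← finrank_cycleSpace hN, ← span_cycles_eq_cycleSpace]
    exact Submodule.exists_fun_fin_finrank_span_eq (ZMod 2) _
  choose C hC hCf using hf
  have hfun : (fun i => edgeVector (C i)) = f := funext hCf
  exact ⟨C, hC, hfun ▸ hli, hfun ▸ hspan⟩

theorem exists_isMinimalCycleBasis (hN : N.Connected) :
    ∃ C : Fin (cycleRank N) → N.Subgraph, IsMinimalCycleBasis C := by
  obtain ⟨C, hC, hmin⟩ := exists_minimalFor_of_wellFoundedLT
    (fun C : Fin (cycleRank N) → N.Subgraph => IsCycleBasis C)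
    (fun C => ∑ i, length (C i)) (exists_isCycleBasis hN)
  refine ⟨C, hC, fun C' hC' => ?_⟩
  rcases le_total (∑ i, length (C i)) (∑ i, length (C' i)) with h | h
  · exact h
  · exact hmin hC' h

end CycleSpace

/-! ### Subdividing the root edge -/

section InsertRoot

variable {V : Type*} {N : SimpleGraph V} {e : Sym2 V}

open Classical in
/-- The neighbour of `v` in the direction of `w` after the edge `e` has been subdivided. -/
noncomputable def via (e : Sym2 V) (v w : V) : Option V := if s(v, w) = e then none else some w

theorem via_of_eq {v w : V} (h : s(v, w) = e) : via e v w = none := if_pos h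

theorem via_of_ne {v w : V} (h : s(v, w) ≠ e) : via e v w = some w := if_neg h

theorem via_injective (e : Sym2 V) (v : V) : Function.Injective (via e v) := by
  intro w w' h
  by_cases h1 : s(v, w) = e <;> by_cases h2 : s(v, w') = e
  · exact Sym2.congr_right.1 (h1.trans h2.symm)
  · simp [via, h1, h2] at h
  · simp [via, h1, h2] at h
  · simpa [via, h1, h2] using h

theorem insertRoot_adj_some_some {a b : V} :
    (insertRoot N e).Adj (some a) (some b) ↔ N.Adj a b ∧ s(a, b) ≠ e := by
  simp only [insertRoot, fromRel_adj, ne_eq, Option.some.injEq]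
  constructor
  · rintro ⟨-, h | h⟩
    · exact h
    · exact ⟨h.1.symm, Sym2.eq_swap (a := a) ▸ h.2⟩
  · exact fun h => ⟨h.1.ne, Or.inl h⟩

theorem insertRoot_adj_none_some {a : V} : (insertRoot N e).Adj none (some a) ↔ a ∈ e := by
  simp [insertRoot]

/-- Neighbours after the subdivision are parametrised by neighbours in `N` through `via`, which
preserves degrees and avoids treating the root edge separately. -/
theorem insertRoot_adj_some (he : e ∈ N.edgeSet) {v : V} {a : Option V} :
    (insertRoot N e).Adj (some v) a ↔ ∃ w, N.Adj v w ∧ via e v w = a := by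
  cases a with
  | none =>
    rw [adj_comm, insertRoot_adj_none_some]
    constructor
    · intro h
      obtain ⟨w, rfl⟩ := Sym2.mem_iff_exists.1 h
      exact ⟨w, he, via_of_eq rfl⟩
    · rintro ⟨w, -, h⟩
      by_cases h1 : s(v, w) = e
      · exact h1 ▸ Sym2.mem_mk_left v w
      · simp [via_of_ne h1] at h
  | some b =>
    rw [insertRoot_adj_some_some]
    constructor
    · exact fun h => ⟨b, h.1, via_of_ne h.2⟩
    · rintro ⟨w, hw, h⟩
      by_cases h1 : s(v, w) = e
      · simp [via_of_eq h1] at h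
      · rw [via_of_ne h1, Option.some.injEq] at h
        exact h ▸ ⟨hw, h1⟩

theorem neighborSet_insertRoot_some (he : e ∈ N.edgeSet) (v : V) :
    (insertRoot N e).neighborSet (some v) = via e v '' N.neighborSet v := by
  ext a
  simpa using insertRoot_adj_some he

theorem ncard_neighborSet_insertRoot_some (he : e ∈ N.edgeSet) (v : V) :
    ((insertRoot N e).neighborSet (some v)).ncard = (N.neighborSet v).ncard := by
  rw [neighborSet_insertRoot_some he, Set.ncard_image_of_injective _ (via_injective e v)]

theorem ncard_neighborSet_insertRoot_none (he : e ∈ N.edgeSet) :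
    ((insertRoot N e).neighborSet none).ncard = 2 := by
  induction e with | h a b
  have : (insertRoot N s(a, b)).neighborSet none = {some a, some b} := by
    ext x
    cases x with
    | none => simp
    | some x => simp [insertRoot_adj_none_some]
  rw [this, Set.ncard_pair]
  have : a ≠ b := N.ne_of_adj he
  simpa using this

theorem connected_insertRoot (hN : N.Connected) (he : e ∈ N.edgeSet) :
    (insertRoot N e).Connected := by
  have hstep : ∀ a b, N.Adj a b → (insertRoot N e).Reachable (some a) (some b) := by
    intro a b hab
    by_cases h : s(a, b) = e
    · have ha : (insertRoot N e).Adj none (some a) :=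
        insertRoot_adj_none_some.2 (h ▸ Sym2.mem_mk_left a b)
      have hb : (insertRoot N e).Adj none (some b) :=
        insertRoot_adj_none_some.2 (h ▸ Sym2.mem_mk_right a b)
      exact ha.symm.reachable.trans hb.reachable
    · exact (insertRoot_adj_some_some.2 ⟨hab, h⟩).reachable
  have hall : ∀ a b, (insertRoot N e).Reachable (some a) (some b) := by
    intro a b
    obtain ⟨p⟩ := hN.preconnected a b
    induction p with
    | nil => exact Reachable.refl _
    | cons h p ih => exact (hstep _ _ h).trans ih
  obtain ⟨v, hv⟩ : ∃ v, (insertRoot N e).Adj none (some v) := by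
    induction e with | h a b
    exact ⟨a, insertRoot_adj_none_some.2 (Sym2.mem_mk_left a b)⟩
  rw [connected_iff_exists_forall_reachable]
  refine ⟨some v, fun x => ?_⟩
  cases x with
  | none => exact hv.symm.reachable
  | some x => exact hall v x

end InsertRoot

/-! ### Finite acyclic digraphs -/

section Digraph

variable {W : Type*} {D : Digraph W}

theorem IsAcyclic.not_adj_self (h : IsAcyclic D) (a : W) : ¬ D.Adj a a :=
  fun hc => h a (Relation.TransGen.single hc)

theorem IsAcyclic.asymm (h : IsAcyclic D) {a b : W} (hab : D.Adj a b) : ¬ D.Adj b a :=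
  fun hc => h a ((Relation.TransGen.single hab).tail hc)

/-- A nonempty set of vertices of a finite acyclic digraph has a member without children in it. -/
theorem IsAcyclic.exists_maximal [Finite W] (h : IsAcyclic D) {S : Set W} (hS : S.Nonempty) :
    ∃ a ∈ S, ∀ b ∈ S, ¬ D.Adj a b := by
  have : IsTrans W (flip (Relation.TransGen D.Adj)) := ⟨fun a b c h1 h2 => h2.trans h1⟩
  have : Std.Irrefl (flip (Relation.TransGen D.Adj)) := ⟨fun a => h a⟩
  have hwf := Finite.wellFounded_of_trans_of_irrefl (flip (Relation.TransGen D.Adj))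
  obtain ⟨a, ha, hmin⟩ := hwf.has_min S hS
  exact ⟨a, ha, fun b hb hab => hmin b hb (Relation.TransGen.single hab)⟩

theorem indeg_pos [Finite W] {a b : W} (h : D.Adj a b) : 0 < indeg D b :=
  (Set.ncard_pos (Set.toFinite _)).2 ⟨a, h⟩

theorem outdeg_pos [Finite W] {a b : W} (h : D.Adj a b) : 0 < outdeg D a :=
  (Set.ncard_pos (Set.toFinite _)).2 ⟨b, h⟩

theorem IsAcyclic.underlying_adj (h : IsAcyclic D) {a b : W} :
    (underlying D).Adj a b ↔ D.Adj a b ∨ D.Adj b a := by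
  simp only [underlying, fromRel_adj]
  refine ⟨fun h => h.2, fun h' => ⟨?_, h'⟩⟩
  rintro rfl
  rcases h' with h' | h' <;> exact h.not_adj_self _ h'

theorem IsAcyclic.indeg_add_outdeg [Finite W] (h : IsAcyclic D) (a : W) :
    indeg D a + outdeg D a = ((underlying D).neighborSet a).ncard := by
  have hu : (underlying D).neighborSet a = {u | D.Adj u a} ∪ {w | D.Adj a w} := by
    ext b
    simp [h.underlying_adj, or_comm]
  rw [hu, Set.ncard_union_eq _ (Set.toFinite _) (Set.toFinite _)]
  · rfl
  · rw [Set.disjoint_left]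
    exact fun b hb hb' => h.asymm hb hb'

theorem sum_indeg_eq_sum_outdeg [Fintype W] (D : Digraph W) :
    ∑ a, indeg D a = ∑ a, outdeg D a := by
  classical
  have h1 : ∀ a, indeg D a = ∑ b, if D.Adj b a then 1 else 0 := by
    intro a
    rw [indeg, Set.ncard_eq_toFinset_card', Finset.sum_boole]
    simp
  have h2 : ∀ a, outdeg D a = ∑ b, if D.Adj a b then 1 else 0 := by
    intro a
    rw [outdeg, Set.ncard_eq_toFinset_card', Finset.sum_boole]
    simp
  simp only [h1, h2]
  exact Finset.sum_comm

/-- A vertex with a parent is not the root, so a child that is no reticulation is a tree vertex or a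
leaf; and exactly the leaves are childless. -/
theorem IsDirectedBinaryNetwork.passesTest_iff [Fintype W] (h : IsDirectedBinaryNetwork D) :
    PassesTest D ↔ IsTreeChild D := by
  constructor
  · intro hp v hv
    have hout : 0 < outdeg D v := by
      rcases h.vertex_types v with h' | h' | h' | h'
      · exact h'.2 ▸ Nat.two_pos
      · exact h'.2 ▸ Nat.two_pos
      · exact h'.2 ▸ Nat.one_pos
      · exact absurd h' hv
    obtain ⟨w, hw⟩ := (Set.ncard_pos (Set.toFinite _)).1 hout
    have : ∃ w, D.Adj v w ∧ ¬ IsReticulation D w := by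
      by_contra! hc
      exact hp ⟨v, ⟨w, hw⟩, hc⟩
    obtain ⟨w, hw, hr⟩ := this
    refine ⟨w, hw, ?_⟩
    rcases h.vertex_types w with h' | h' | h' | h'
    · exact absurd h'.1 (indeg_pos hw).ne'
    · exact Or.inl h'
    · exact absurd h' hr
    · exact Or.inr h'
  · rintro ht ⟨v, ⟨w, hw⟩, hall⟩
    obtain ⟨x, hx, hx'⟩ := ht v fun hl => (outdeg_pos hw).ne' hl.2
    have h2 := (hall x hx).1
    rcases hx' with hx' | hx' <;> have := hx'.1 <;> omega

end Digraph

/-! ### Orientations -/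

section Orientation

variable {V : Type*} {N : SimpleGraph V} {e : Sym2 V} {D : Digraph (Option V)}

theorem desiredIndeg_eq_two {n : ℕ} {s : Fin n → V} {v : V} (h : v ∈ Set.range s) :
    desiredIndeg s v = 2 := if_pos h

theorem desiredIndeg_eq_one {n : ℕ} {s : Fin n → V} {v : V} (h : v ∉ Set.range s) :
    desiredIndeg s v = 1 := if_neg h

variable [Fintype V]

theorem sum_ncard_neighborSet (N : SimpleGraph V) :
    ∑ v, (N.neighborSet v).ncard = 2 * N.edgeSet.ncard := by
  classical
  have := N.sum_degrees_eq_twice_card_edges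
  rw [← Set.ncard_coe_finset, coe_edgeFinset] at this
  rw [← this]
  refine Finset.sum_congr rfl fun v _ => ?_
  rw [Set.ncard_eq_toFinset_card', ← card_neighborFinset_eq_degree, neighborFinset]

theorem indeg_add_outdeg_some (he : e ∈ N.edgeSet) (hac : IsAcyclic D)
    (hu : underlying D = insertRoot N e) (v : V) :
    indeg D (some v) + outdeg D (some v) = (N.neighborSet v).ncard := by
  rw [hac.indeg_add_outdeg, hu, ncard_neighborSet_insertRoot_some he]

/-- Each arc has one head, and subdividing the root edge leaves |E| + 1 arcs. -/
theorem sum_indeg (he : e ∈ N.edgeSet) (hac : IsAcyclic D)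
    (hu : underlying D = insertRoot N e) (h0 : indeg D none = 0) :
    ∑ v, indeg D (some v) = N.edgeSet.ncard + 1 := by
  have h1 : ∑ a, (indeg D a + outdeg D a) = 2 + 2 * N.edgeSet.ncard := by
    rw [Fintype.sum_option, hac.indeg_add_outdeg, hu, ncard_neighborSet_insertRoot_none he,
      ← sum_ncard_neighborSet]
    congr 1
    exact Finset.sum_congr rfl fun v _ => indeg_add_outdeg_some he hac hu v
  rw [Finset.sum_add_distrib, ← sum_indeg_eq_sum_outdeg, Fintype.sum_option, h0] at h1
  omega

theorem edgeSet_ncard_add_one (hN : N.Connected) :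
    N.edgeSet.ncard + 1 = Fintype.card V + cycleRank N := by
  have h := hN.card_vert_le_card_edgeSet_add_one
  rw [Nat.card_coe_set_eq, Nat.card_eq_fintype_card] at h
  rw [cycleRank]
  omega

theorem IsOrientationAt.adj_iff (hD : IsOrientationAt N e D) {a b : Option V} :
    (insertRoot N e).Adj a b ↔ D.Adj a b ∨ D.Adj b a := by
  rw [← hD.2.2.2, hD.2.1.acyclic.underlying_adj]

theorem IsOrientationAt.adj_via (hD : IsOrientationAt N e D) {v w : V} (h : N.Adj v w) :
    D.Adj (some v) (via e v w) ∨ D.Adj (via e v w) (some v) :=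
  hD.adj_iff.1 ((insertRoot_adj_some hD.1).2 ⟨w, h, rfl⟩)

theorem IsOrientationAt.not_adj_none (hD : IsOrientationAt N e D) (a : Option V) :
    ¬ D.Adj a none := fun h => (indeg_pos h).ne' hD.2.2.1.1

theorem IsOrientationAt.vertex_types (hD : IsOrientationAt N e D) (v : V) :
    IsTreeVertex D (some v) ∨ IsReticulation D (some v) ∨ IsLeaf D (some v) := by
  rcases hD.2.1.vertex_types (some v) with h | h
  · have := hD.2.1.exists_unique_root.unique h hD.2.2.1
    simp at this
  · exact h

theorem IsOrientationAt.isReticulation_iff (hD : IsOrientationAt N e D) {v : V} :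
    IsReticulation D (some v) ↔ 2 ≤ indeg D (some v) := by
  constructor
  · exact fun h => h.1.ge
  · intro h
    rcases hD.vertex_types v with h' | h' | h'
    · have := h'.1; omega
    · exact h'
    · have := h'.1; omega

open Classical in
theorem IsOrientationAt.indeg_eq (hD : IsOrientationAt N e D) (v : V) :
    indeg D (some v) = if IsReticulation D (some v) then 2 else 1 := by
  split_ifs with h
  · exact h.1
  · rcases hD.vertex_types v with h' | h' | h'
    · exact h'.1
    · exact absurd h' h
    · exact h'.1

/-- The in-degrees over V sum to |V| plus the number of reticulations, and also to |E| + 1 = |V| +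
r. -/
theorem IsOrientationAt.ncard_reticulations (hN : N.Connected) (hD : IsOrientationAt N e D) :
    {v | IsReticulation D (some v)}.ncard = cycleRank N := by
  classical
  have h1 := sum_indeg hD.1 hD.2.1.acyclic hD.2.2.2 hD.2.2.1.1
  have h2 : ∀ v, indeg D (some v) = 1 + if IsReticulation D (some v) then 1 else 0 := by
    intro v
    rw [hD.indeg_eq]
    split_ifs <;> rfl
  rw [edgeSet_ncard_add_one hN] at h1
  simp only [h2, Finset.sum_add_distrib, Finset.sum_boole] at h1
  rw [Set.ncard_eq_toFinset_card']
  simp at h1 ⊢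
  exact h1

theorem IsOrientationAt.satisfiesConstraint (hD : IsOrientationAt N e D) {n : ℕ} {s : Fin n → V}
    (hs : Set.range s = {v | IsReticulation D (some v)}) :
    SatisfiesConstraint N e (desiredIndeg s) D := by
  classical
  refine ⟨hD, fun v => ?_⟩
  have hm : v ∈ Set.range s ↔ IsReticulation D (some v) := by rw [hs]; rfl
  by_cases h : IsReticulation D (some v)
  · rw [desiredIndeg_eq_two (hm.2 h), h.1]
  · rw [desiredIndeg_eq_one fun h' => h (hm.1 h'), hD.indeg_eq, if_neg h]

theorem SatisfiesConstraint.isReticulation_iff {n : ℕ} {s : Fin n → V}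
    (hD : SatisfiesConstraint N e (desiredIndeg s) D) {v : V} :
    IsReticulation D (some v) ↔ v ∈ Set.range s := by
  rw [hD.1.isReticulation_iff, hD.2]
  by_cases h : v ∈ Set.range s
  · simp [desiredIndeg_eq_two h, h]
  · simp [desiredIndeg_eq_one h, h]

/-! ### Uniqueness of constrained orientations -/

/-- Among the heads of arcs of `D` that `D'` reverses, take one, y, with no child among them. Equal
in-degrees at y give an arc z → y of `D'` that `D` reverses, so z is a child of y in `D` and again
such a head, a contradiction. -/
theorem SatisfiesConstraint.adj_imp {δ : V → ℕ} {D' : Digraph (Option V)}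
    (hD : SatisfiesConstraint N e δ D) (hD' : SatisfiesConstraint N e δ D') {a b : Option V}
    (hab : D.Adj a b) : D'.Adj a b := by
  by_contra hc
  have hdeg : ∀ x, indeg D x = indeg D' x := by
    intro x
    cases x with
    | none => rw [hD.1.2.2.1.1, hD'.1.2.2.1.1]
    | some v => rw [hD.2, hD'.2]
  have hswap : ∀ {D₁ D₂ : Digraph (Option V)}, IsOrientationAt N e D₁ → IsOrientationAt N e D₂ →
      ∀ {x y}, D₁.Adj x y → ¬ D₂.Adj x y → D₂.Adj y x := fun h1 h2 x y hxy hn =>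
    (h2.adj_iff.1 (h1.adj_iff.2 (Or.inl hxy))).resolve_left hn
  obtain ⟨y, ⟨x, hx, hx'⟩, hmax⟩ := hD.1.2.1.acyclic.exists_maximal
    (S := {y | ∃ x, D.Adj x y ∧ ¬ D'.Adj x y}) ⟨b, a, hab, hc⟩
  obtain ⟨z, hz, hz'⟩ : ∃ z, D'.Adj z y ∧ ¬ D.Adj z y := by
    by_contra! hsub
    have := Set.eq_of_subset_of_ncard_le (s := {u | D'.Adj u y}) (t := {u | D.Adj u y})
      hsub (hdeg y).le (Set.toFinite _)
    exact hx' (this.symm ▸ hx : x ∈ {u | D'.Adj u y})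
  have hyz := hswap hD'.1 hD.1 hz hz'
  exact hmax z ⟨y, hyz, hD'.1.2.1.acyclic.asymm hz⟩ hyz

theorem SatisfiesConstraint.unique {δ : V → ℕ} {D' : Digraph (Option V)}
    (hD : SatisfiesConstraint N e δ D) (hD' : SatisfiesConstraint N e δ D') : D = D' := by
  ext a b
  exact ⟨hD.adj_imp hD', hD'.adj_imp hD⟩

/-! ### Reticulations and the cycle space -/

/-- In an orientation, every nonzero vector of the cycle space has a sink, and a sink is a
reticulation both of whose incoming arcs come from the vector. -/
theorem IsOrientationAt.exists_sink (hD : IsOrientationAt N e D) {z : Sym2 V → ZMod 2}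
    (hz : z ∈ cycleSpace N) (h0 : z ≠ 0) :
    ∃ v, IsReticulation D (some v) ∧ (∃ w, z s(v, w) ≠ 0) ∧
      ∀ a, D.Adj a (some v) ↔ ∃ w, z s(v, w) ≠ 0 ∧ via e v w = a := by
  obtain ⟨f, hf⟩ := Function.ne_iff.1 h0
  induction f with | h x y
  -- A vertex v on z without a child on z. The root is not in the set, but no arc enters it, so the
  -- root edge also points into v.
  obtain ⟨a, ⟨v, ⟨w, hw⟩, rfl⟩, hmax⟩ := hD.2.1.acyclic.exists_maximal
    (S := some '' {v | ∃ w, z s(v, w) ≠ 0}) ⟨some x, x, ⟨y, hf⟩, rfl⟩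
  have hin : ∀ w, z s(v, w) ≠ 0 → D.Adj (via e v w) (some v) := by
    intro w hw
    rcases hD.adj_via (cycleSpace_apply_ne_zero hz hw) with h | h
    · by_cases h1 : s(v, w) = e
      · rw [via_of_eq h1] at h
        exact absurd h (hD.not_adj_none _)
      · rw [via_of_ne h1] at h
        exact absurd h (hmax _ ⟨w, ⟨v, Sym2.eq_swap (a := v) ▸ hw⟩, rfl⟩)
    · exact h
  -- Evenness at the cut {v} gives a second edge of z at v; in-degree at most 2 then makes these two
  -- all the incoming arcs.
  obtain ⟨v', rfl, w', -, hw', hne⟩ := cycleSpace_exists_second_cut_edge hz (B := {v})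
    (Set.mem_singleton v) (fun h => (cycleSpace_apply_ne_zero hz hw).ne h.symm) hw
  have hww : w' ≠ w := fun h => hne (by rw [h])
  have hpair : ({via e v' w', via e v' w} : Set (Option V)).ncard = 2 :=
    Set.ncard_pair fun h => hww (via_injective e v' h)
  have hsub : ({via e v' w', via e v' w} : Set (Option V)) ⊆ {u | D.Adj u (some v')} := by
    rintro _ (rfl | rfl)
    · exact hin _ hw'
    · exact hin _ hw
  have hret : IsReticulation D (some v') := by
    rw [hD.isReticulation_iff, ← hpair]
    exact Set.ncard_le_ncard hsub (Set.toFinite _)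
  refine ⟨v', hret, ⟨w, hw⟩, fun a => ⟨fun ha => ?_, ?_⟩⟩
  · have heq := Set.eq_of_subset_of_ncard_le hsub (by rw [hpair]; exact hret.1.le) (Set.toFinite _)
    have ha' : a ∈ ({via e v' w', via e v' w} : Set (Option V)) := heq ▸ ha
    rcases ha' with rfl | rfl
    · exact ⟨w', hw', rfl⟩
    · exact ⟨w, hw, rfl⟩
  · rintro ⟨u, hu, rfl⟩
    exact hin u hu

/-- Two distinct nonzero vectors of the cycle space have distinct representatives among the
reticulations of an orientation. -/
theorem IsOrientationAt.exists_reticulation_pair (hD : IsOrientationAt N e D)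
    {z₁ z₂ : Sym2 V → ZMod 2} (hz₁ : z₁ ∈ cycleSpace N) (hz₂ : z₂ ∈ cycleSpace N)
    (h₁ : z₁ ≠ 0) (h₂ : z₂ ≠ 0) (hne : z₁ ≠ z₂) :
    ∃ x y, x ≠ y ∧ IsReticulation D (some x) ∧ IsReticulation D (some y) ∧
      (∃ w, z₁ s(x, w) ≠ 0) ∧ ∃ w, z₂ s(y, w) ≠ 0 := by
  obtain ⟨x, hx, hxw, hxa⟩ := hD.exists_sink hz₁ h₁
  obtain ⟨y, hy, hyw, hya⟩ := hD.exists_sink hz₂ h₂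
  by_cases hxy : x = y
  · subst hxy
    -- If both vectors have the same sink x, its two incoming arcs make them agree at x. So z₁ + z₂
    -- vanishes at x, its sink is a different vertex, and that vertex lies on z₁ or z₂.
    have hagree : ∀ w, z₁ s(x, w) ≠ 0 ↔ z₂ s(x, w) ≠ 0 := by
      intro w
      have h1 := (hxa (via e x w)).symm.trans (hya (via e x w))
      have hz : ∀ z : Sym2 V → ZMod 2,
          (∃ u, z s(x, u) ≠ 0 ∧ via e x u = via e x w) ↔ z s(x, w) ≠ 0 := by
        refine fun z => ⟨?_, fun h => ⟨w, h, rfl⟩⟩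
        rintro ⟨u, hu, h⟩
        exact via_injective e x h ▸ hu
      rwa [hz, hz] at h1
    have h0 : z₁ + z₂ ≠ 0 := by
      intro h
      apply hne
      funext f
      have := congrFun h f
      rw [Pi.add_apply, Pi.zero_apply, CharTwo.add_eq_zero] at this
      exact this
    obtain ⟨v, hv, ⟨w, hw⟩, -⟩ := hD.exists_sink ((cycleSpace N).add_mem hz₁ hz₂) h0
    have hvx : v ≠ x := by
      rintro rfl
      apply hw
      rw [Pi.add_apply]
      by_cases h : z₁ s(v, w) = 0
      · have h' : z₂ s(v, w) = 0 := by
          by_contra hc; exact (hagree w).2 hc h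
        rw [h, h', add_zero]
      · rw [zmod_two_eq_one h, zmod_two_eq_one ((hagree w).1 h)]
        exact CharTwo.add_self_eq_zero _
    by_cases h : z₁ s(v, w) = 0
    · rw [Pi.add_apply, h, zero_add] at hw
      exact ⟨x, v, hvx.symm, hx, hv, hxw, w, hw⟩
    · exact ⟨v, x, hvx, hv, hx, ⟨w, h⟩, hyw⟩
  · exact ⟨x, y, hxy, hx, hy, hxw, hyw⟩

/-- Reticulations of a tree-child orientation are not adjacent in the network. -/
theorem IsOrientationAt.two_le_dist (hN : N.Connected) (hD : IsOrientationAt N e D)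
    (ht : IsTreeChild D) {x y : V} (hxy : x ≠ y) (hx : IsReticulation D (some x))
    (hy : IsReticulation D (some y)) : 2 ≤ N.dist x y := by
  apply hN.one_lt_dist_of_ne_of_not_adj hxy
  intro hadj
  have hp := hD.2.1.passesTest_iff.2 ht
  -- A reticulation has a single child, so a reticulation as that child violates the test.
  have harc : ∀ x y : V, IsReticulation D (some x) → IsReticulation D (some y) →
      ¬ D.Adj (some x) (some y) := by
    intro x y hx hy h
    obtain ⟨c, hc⟩ := Set.ncard_eq_one.1 hx.2
    refine hp ⟨some x, ⟨_, h⟩, fun w hw => ?_⟩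
    have h1 : w ∈ ({c} : Set (Option V)) := hc ▸ hw
    have h2 : some y ∈ ({c} : Set (Option V)) := hc ▸ h
    rw [Set.mem_singleton_iff] at h1 h2
    rwa [h1, ← h2]
  -- If xy is the root edge, there is no arc between x and y; instead both children of the root are
  -- reticulations.
  by_cases he : s(x, y) = e
  · refine hp ⟨none, ?_, ?_⟩
    · have := (hD.adj_iff (a := none) (b := some x)).1
        (insertRoot_adj_none_some.2 (he ▸ Sym2.mem_mk_left x y))
      exact ⟨_, this.resolve_right (hD.not_adj_none _)⟩
    · intro w hw
      cases w with
      | none => exact absurd hw (hD.not_adj_none _)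
      | some w =>
        have := insertRoot_adj_none_some.1 (hD.adj_iff.2 (Or.inl hw))
        rw [← he, Sym2.mem_iff] at this
        rcases this with rfl | rfl
        · exact hx
        · exact hy
  · rcases hD.adj_iff.1 (insertRoot_adj_some_some.2 ⟨hadj, he⟩) with h | h
    · exact harc _ _ hx hy h
    · exact harc _ _ hy hx h

end Orientation

/-! ### Existence of constrained orientations -/

section Existence

/-- If every proper vertex set that contains `ρ` has an outside vertex `v` with at least `δ v`
neighbours in it, the vertices can be ordered, starting with `ρ`, such that every other vertex `v`
has at least `δ v` earlier neighbours. -/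
theorem exists_ordering {W : Type*} [Fintype W] (G : SimpleGraph W) (ρ : W) (δ : W → ℕ)
    (hext : ∀ A : Set W, ρ ∈ A → A ≠ Set.univ →
      ∃ v ∉ A, δ v ≤ {a | a ∈ A ∧ G.Adj a v}.ncard) :
    ∃ h : W → ℕ, Function.Injective h ∧ (∀ w, ¬ h w < h ρ) ∧
      ∀ v, v ≠ ρ → δ v ≤ {a | G.Adj a v ∧ h a < h v}.ncard := by
  classical
  -- Greedy construction: A holds the first k + 1 vertices, labelled by at most k, and the next
  -- vertex gets label k + 1.
  have key : ∀ k, k + 1 ≤ Fintype.card W → ∃ A : Finset W, A.card = k + 1 ∧ ρ ∈ A ∧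
      ∃ h : W → ℕ, Set.InjOn h A ∧ (∀ a ∈ A, h a ≤ k) ∧ h ρ = 0 ∧
        ∀ v ∈ A, v ≠ ρ → δ v ≤ {a | a ∈ A ∧ G.Adj a v ∧ h a < h v}.ncard := by
    intro k
    induction k with
    | zero =>
      intro _
      refine ⟨{ρ}, rfl, by simp, fun _ => 0, by simp, by simp, rfl, ?_⟩
      intro v hv hne
      exact absurd (by simpa using hv) hne
    | succ k ih =>
      intro hk
      obtain ⟨A, hcard, hρ, h, hinj, hle, h0, hδ⟩ := ih (by omega)
      obtain ⟨v, hvA, hv⟩ := hext A (by simpa using hρ) (by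
        intro hu
        have : A = Finset.univ := by exact_mod_cast hu
        rw [this, Finset.card_univ] at hcard
        omega)
      have hvA' : v ∉ A := by simpa using hvA
      have hA : ∀ a ∈ A, Function.update h v (k + 1) a = h a := fun a ha =>
        Function.update_of_ne (fun hc : a = v => hvA' (hc ▸ ha)) _ _
      refine ⟨insert v A, by rw [Finset.card_insert_of_notMem hvA', hcard], by simp [hρ],
        Function.update h v (k + 1), ?_, ?_, by rw [hA ρ hρ, h0], ?_⟩
      · intro a ha b hb hab
        simp only [Finset.coe_insert, Set.mem_insert_iff, Finset.mem_coe] at ha hb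
        rcases ha with rfl | ha <;> rcases hb with rfl | hb
        · rfl
        · rw [hA b hb, Function.update_self] at hab
          have := hle b hb; omega
        · rw [hA a ha, Function.update_self] at hab
          have := hle a ha; omega
        · rw [hA a ha, hA b hb] at hab
          exact hinj ha hb hab
      · intro a ha
        rcases Finset.mem_insert.1 ha with rfl | ha
        · simp
        · rw [hA a ha]; exact (hle a ha).trans (Nat.le_succ k)
      · intro w hw hne
        rcases Finset.mem_insert.1 hw with rfl | hw
        · refine hv.trans (Set.ncard_le_ncard ?_ (Set.toFinite _))
          rintro a ⟨ha, hadj⟩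
          refine ⟨Finset.mem_insert_of_mem ha, hadj, ?_⟩
          rw [hA a ha, Function.update_self]
          exact Nat.lt_succ_of_le (hle a ha)
        · refine (hδ w hw hne).trans (Set.ncard_le_ncard ?_ (Set.toFinite _))
          rintro a ⟨ha, hadj, hlt⟩
          refine ⟨Finset.mem_insert_of_mem ha, hadj, ?_⟩
          rwa [hA a ha, hA w hw]
  have hpos : 0 < Fintype.card W := Fintype.card_pos_iff.2 ⟨ρ⟩
  obtain ⟨A, hcard, -, h, hinj, -, h0, hδ⟩ := key (Fintype.card W - 1) (by omega)
  have hA : A = Finset.univ := by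
    rw [← Finset.card_eq_iff_eq_univ]; omega
  subst hA
  refine ⟨h, by simpa using hinj, by simp [h0], fun v hv => ?_⟩
  simpa using hδ v (Finset.mem_univ v) hv

variable {V : Type*} [Fintype V] {N : SimpleGraph V} {e : Sym2 V}

theorem sum_desiredIndeg {n : ℕ} {s : Fin n → V} (hs : Function.Injective s) :
    ∑ v, desiredIndeg s v = Fintype.card V + n := by
  classical
  have h : ∀ v, desiredIndeg s v = 1 + if v ∈ Set.range s then 1 else 0 := by
    intro v
    by_cases hv : v ∈ Set.range s
    · rw [desiredIndeg_eq_two hv, if_pos hv]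
    · rw [desiredIndeg_eq_one hv, if_neg hv]
  simp only [h, Finset.sum_add_distrib, Finset.sum_boole]
  have h2 : (Finset.univ.filter fun v => v ∈ Set.range s) = Finset.univ.image s := by
    ext v; simp
  rw [h2, Finset.card_image_of_injective _ hs]
  simp

/-- The constrained orientation exists if there is no obstruction `B`. -/
theorem exists_satisfiesConstraint (hN : IsUndirectedBinaryNetwork N) (he : e ∈ N.edgeSet) {n : ℕ}
    (hn : cycleRank N = n) {s : Fin n → V} (hs : Function.Injective s)
    (hdeg : ∀ i, (N.neighborSet (s i)).ncard = 3)
    (hB : ∀ B : Set V, B.Nonempty →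
      ∃ v ∈ B, desiredIndeg s v ≤ {w | N.Adj v w ∧ (s(v, w) = e ∨ w ∉ B)}.ncard) :
    ∃ D, SatisfiesConstraint N e (desiredIndeg s) D := by
  classical
  -- With B the vertices of V not yet reached, the edges from v ∈ B to reached vertices are those
  -- leaving B and the root edge, which leads to the root.
  obtain ⟨h, hinj, h0, hδ⟩ := exists_ordering (insertRoot N e) none
    (fun a => a.elim 0 (desiredIndeg s)) (by
      intro A hA hne
      have hBne : {v | some v ∉ A}.Nonempty := by
        by_contra hc
        apply hne
        rw [Set.eq_univ_iff_forall]
        intro a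
        cases a with
        | none => exact hA
        | some v =>
          by_contra hv
          exact hc ⟨v, hv⟩
      obtain ⟨v, hv, hle⟩ := hB _ hBne
      refine ⟨some v, hv, hle.trans ?_⟩
      rw [← Set.ncard_image_of_injective _ (via_injective e v)]
      refine Set.ncard_le_ncard ?_ (Set.toFinite _)
      rintro _ ⟨w, ⟨hvw, hw⟩, rfl⟩
      refine ⟨?_, ((insertRoot_adj_some he).2 ⟨w, hvw, rfl⟩).symm⟩
      by_cases h1 : s(v, w) = e
      · rwa [via_of_eq h1]
      · rw [via_of_ne h1]
        simpa using hw.resolve_left h1)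
  -- Every edge is directed from the earlier to the later vertex.
  let D : Digraph (Option V) := ⟨fun a b => (insertRoot N e).Adj a b ∧ h a < h b⟩
  have hlt : ∀ a b, Relation.TransGen D.Adj a b → h a < h b := by
    intro a b hab
    induction hab with
    | single h1 => exact h1.2
    | tail _ h1 ih => exact ih.trans h1.2
  have hac : IsAcyclic D := fun a ha => lt_irrefl _ (hlt a a ha)
  have hu : underlying D = insertRoot N e := by
    ext a b
    rw [hac.underlying_adj]
    constructor
    · rintro (h1 | h1)
      · exact h1.1
      · exact h1.1.symm
    · intro hab
      rcases lt_or_gt_of_ne (fun hc => hab.ne (hinj hc)) with h1 | h1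
      · exact Or.inl ⟨hab, h1⟩
      · exact Or.inr ⟨hab.symm, h1⟩
  have hroot : indeg D none = 0 := by
    rw [indeg, Set.ncard_eq_zero (Set.toFinite _)]
    exact Set.eq_empty_of_forall_notMem fun a ha => h0 a ha.2
  have hsum := sum_indeg he hac hu hroot
  have hge : ∀ v, desiredIndeg s v ≤ indeg D (some v) := fun v => hδ (some v) (by simp)
  -- The ordering gives only lower bounds on the in-degrees. Both sides sum to |V| + n = |E| + 1, so
  -- equality holds everywhere.
  have hind : ∀ v, indeg D (some v) = desiredIndeg s v := by
    have := (Finset.sum_eq_sum_iff_of_le (s := Finset.univ) (fun v _ => hge v)).1 (by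
      rw [hsum, sum_desiredIndeg hs, edgeSet_ncard_add_one hN.connected, hn])
    exact fun v => (this v (Finset.mem_univ v)).symm
  have hrootD : IsRoot D none := by
    refine ⟨hroot, ?_⟩
    have := hac.indeg_add_outdeg none
    rw [hu, ncard_neighborSet_insertRoot_none he] at this
    omega
  have hadd := indeg_add_outdeg_some he hac hu
  refine ⟨D, ⟨he, ⟨hac, ?_, ⟨none, hrootD, ?_⟩, ?_⟩, hrootD, hu⟩, hind⟩
  · rw [hu]; exact connected_insertRoot hN.connected he
  · intro a ha
    cases a with
    | none => rfl
    | some v =>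
      have h1 := ha.1
      rw [hind v, desiredIndeg] at h1
      split_ifs at h1
  · intro a
    cases a with
    | none => exact Or.inl hrootD
    | some v =>
      right
      have h1 := hadd v
      by_cases hv : v ∈ Set.range s
      · obtain ⟨i, rfl⟩ := hv
        have h2 := hind (s i)
        rw [desiredIndeg_eq_two ⟨i, rfl⟩] at h2
        rw [hdeg i] at h1
        exact Or.inr (Or.inl ⟨h2, by omega⟩)
      · have h2 := hind v
        rw [desiredIndeg_eq_one hv] at h2
        rcases hN.degrees v with h3 | h3
        · exact Or.inr (Or.inr ⟨h2, by omega⟩)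
        · exact Or.inl ⟨h2, by omega⟩

end Existence

/-! ### Cycles -/

section Cycle

variable {V : Type*} {N : SimpleGraph V} {C : N.Subgraph}

theorem IsCycleOf.ncard_neighborSet (hC : IsCycleOf N C) {v : V} (hv : v ∈ C.verts) :
    (C.neighborSet v).ncard = 2 := by
  obtain ⟨u, p, hp, rfl⟩ := hC
  exact hp.ncard_neighborSet_toSubgraph_eq_two (p.mem_verts_toSubgraph.1 hv)

theorem IsCycleOf.exists_adj (hC : IsCycleOf N C) {v : V} (hv : v ∈ C.verts) : ∃ w, C.Adj v w := by
  have h := hC.ncard_neighborSet hv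
  exact Set.nonempty_of_ncard_ne_zero (s := C.neighborSet v) (by omega)

theorem edgeVector_apply_ne_zero {v w : V} : edgeVector C s(v, w) ≠ 0 ↔ C.Adj v w :=
  edgeVector_ne_zero_iff

theorem IsCycleOf.exists_cut_edge (hC : IsCycleOf N C) {B : Set V} {x y : V} (hx : x ∈ C.verts)
    (hy : y ∈ C.verts) (hxB : x ∈ B) (hyB : y ∉ B) : ∃ v ∈ B, ∃ w ∉ B, C.Adj v w := by
  obtain ⟨u, p, hp, rfl⟩ := hC
  have hconn := p.toSubgraph_connected
  obtain ⟨q⟩ := hconn.preconnected ⟨x, hx⟩ ⟨y, hy⟩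
  obtain ⟨d, -, h1, h2⟩ := q.exists_boundary_dart {z | z.1 ∈ B} hxB hyB
  exact ⟨_, h1, _, h2, d.adj⟩

theorem ncard_edges_le_length {u v : V} (p : N.Walk u v) : {e | e ∈ p.edges}.ncard ≤ p.length := by
  classical
  rw [← p.length_edges, ← List.coe_toFinset, Set.ncard_coe_finset]
  exact p.edges.toFinset_card_le

theorem ncard_support_walkVector_le {u v : V} (p : N.Walk u v) :
    (Function.support (walkVector p)).ncard ≤ p.length :=
  (Set.ncard_le_ncard (fun _ h => walkVector_ne_zero h) (List.finite_toSet p.edges)).trans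
    (ncard_edges_le_length p)

theorem length_toSubgraph {u : V} {p : N.Walk u u} (hp : p.IsCycle) :
    length p.toSubgraph = p.length := by
  classical
  have : p.toSubgraph.edgeSet = p.edges.toFinset := by
    ext e; rw [Walk.mem_edges_toSubgraph]; simp
  rw [length, this, Set.ncard_coe_finset, List.toFinset_card_of_nodup hp.edges_nodup, p.length_edges]

theorem ncard_verts_toSubgraph {u : V} {p : N.Walk u u} (hp : p.IsCycle) :
    p.toSubgraph.verts.ncard = p.length := by
  classical
  -- The tail drops one of the two occurrences of the base vertex.
  have : p.toSubgraph.verts = p.support.tail.toFinset := by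
    ext w
    rw [Walk.mem_verts_toSubgraph, List.coe_toFinset, Set.mem_ofPred_eq]
    refine ⟨fun h => ?_, List.mem_of_mem_tail⟩
    rw [Walk.mem_support_iff] at h
    rcases h with rfl | h
    · exact Walk.end_mem_tail_support hp.not_nil
    · exact h
  rw [this, Set.ncard_coe_finset, List.toFinset_card_of_nodup hp.support_nodup, List.length_tail,
    p.length_support]
  rfl

theorem IsCycleOf.ncard_verts (hC : IsCycleOf N C) : C.verts.ncard = length C := by
  obtain ⟨u, p, hp, rfl⟩ := hC
  rw [length_toSubgraph hp, ncard_verts_toSubgraph hp]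

theorem IsCycleOf.three_le_length (hC : IsCycleOf N C) : 3 ≤ length C := by
  obtain ⟨u, p, hp, rfl⟩ := hC
  rw [length_toSubgraph hp]
  exact hp.three_le_length

/-- A cycle can be traversed from any of its vertices. -/
theorem IsCycleOf.exists_isCycle (hC : IsCycleOf N C) {v : V} (hv : v ∈ C.verts) :
    ∃ p : N.Walk v v, p.IsCycle ∧ p.toSubgraph = C := by
  classical
  obtain ⟨u, p, hp, rfl⟩ := hC
  have h := p.mem_verts_toSubgraph.1 hv
  exact ⟨p.rotate v h, hp.rotate h, p.toSubgraph_rotate h⟩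

/-- The two arcs between the vertices are walks whose lengths add up to that of the cycle. -/
theorem IsCycleOf.two_mul_dist_le (hC : IsCycleOf N C) {v w : V} (hv : v ∈ C.verts)
    (hw : w ∈ C.verts) : 2 * N.dist v w ≤ length C := by
  classical
  obtain ⟨p, hp, rfl⟩ := hC.exists_isCycle hv
  have h := p.mem_verts_toSubgraph.1 hw
  have h1 := N.dist_le (p.takeUntil w h)
  have h2 := N.dist_le (p.dropUntil w h)
  have h3 := congrArg Walk.length (p.take_spec h)
  rw [Walk.length_append] at h3
  rw [N.dist_comm] at h2
  rw [length_toSubgraph hp]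
  omega

variable [Fintype V]

theorem IsUndirectedBinaryNetwork.ncard_neighborSet (hN : IsUndirectedBinaryNetwork N)
    (hC : IsCycleOf N C) {v : V} (hv : v ∈ C.verts) : (N.neighborSet v).ncard = 3 := by
  have h1 := hC.ncard_neighborSet hv
  have h2 := Set.ncard_le_ncard (C.neighborSet_subset v) (Set.toFinite _)
  rcases hN.degrees v with h | h <;> omega

/-- Cycles that share a vertex share an edge at that vertex. -/
theorem IsUndirectedBinaryNetwork.exists_common_adj (hN : IsUndirectedBinaryNetwork N)
    {C' : N.Subgraph} (hC : IsCycleOf N C) (hC' : IsCycleOf N C') {v : V} (hv : v ∈ C.verts)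
    (hv' : v ∈ C'.verts) : ∃ w, C.Adj v w ∧ C'.Adj v w := by
  by_contra! hc
  -- Two disjoint pairs of neighbours do not fit into three.
  have hd : Disjoint (C.neighborSet v) (C'.neighborSet v) :=
    Set.disjoint_left.2 fun w h h' => hc w h h'
  have h1 := Set.ncard_union_eq hd (Set.toFinite _) (Set.toFinite _)
  have h2 := Set.ncard_le_ncard
    (Set.union_subset (C.neighborSet_subset v) (C'.neighborSet_subset v)) (Set.toFinite _)
  rw [hC.ncard_neighborSet hv, hC'.ncard_neighborSet hv'] at h1
  rw [hN.ncard_neighborSet hC hv] at h2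
  omega

end Cycle

/-! ### Constrained orientations of networks of cycle rank two -/

section RankTwo

variable {V : Type*} {N : SimpleGraph V} {e : Sym2 V} {C₁ C₂ : N.Subgraph} {v₁ v₂ : V}

theorem mem_range_pair {a b v : V} : v ∈ Set.range ![a, b] ↔ v = a ∨ v = b := by
  simp only [Set.mem_range, Fin.exists_fin_two, eq_comm (b := v)]
  rfl

/-- The edges that enter `B` from outside, where the edge `e` counts as entering, all end in `v₁` or
`v₂`, at most one in each. -/
structure IsObstruction (N : SimpleGraph V) (e : Sym2 V) (v₁ v₂ : V) (B : Set V) : Prop where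
  nonempty : B.Nonempty
  eq_or_eq : ∀ v ∈ B, ∀ w, N.Adj v w → (s(v, w) = e ∨ w ∉ B) → v = v₁ ∨ v = v₂
  unique : ∀ v ∈ B, ∀ w w', N.Adj v w → (s(v, w) = e ∨ w ∉ B) → N.Adj v w' →
    (s(v, w') = e ∨ w' ∉ B) → w = w'

theorem IsObstruction.exists_mem (hN : N.Connected) {B : Set V} (hB : IsObstruction N e v₁ v₂ B)
    {c : V} (hc : c ∉ B) : v₁ ∈ B ∨ v₂ ∈ B := by
  obtain ⟨x, hx⟩ := hB.nonempty
  obtain ⟨p⟩ := hN.preconnected x c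
  obtain ⟨d, -, h1, h2⟩ := p.exists_boundary_dart B hx hc
  rcases hB.eq_or_eq _ h1 _ d.adj (Or.inr h2) with h | h
  · exact Or.inl (h ▸ h1)
  · exact Or.inr (h ▸ h1)

/-- An obstruction does not contain both ends of `e`, except if these are the special vertices. -/
theorem IsObstruction.exists_notMem (he : e ∈ N.edgeSet) {B : Set V}
    (hB : IsObstruction N e v₁ v₂ B) (hne : e ≠ s(v₁, v₂)) : ∃ c ∈ e, c ∉ B := by
  induction e with | h a b
  by_contra! hc
  have ha := hc a (Sym2.mem_mk_left a b)
  have hb := hc b (Sym2.mem_mk_right a b)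
  have hab : N.Adj a b := he
  have h1 := hB.eq_or_eq a ha b hab (Or.inl rfl)
  have h2 := hB.eq_or_eq b hb a hab.symm (Or.inl Sym2.eq_swap)
  have h3 := hab.ne
  apply hne
  rw [Sym2.eq_iff]
  grind

variable [Fintype V]

/-- If every vertex of B receives fewer entering edges than its in-degree demands, an ordinary
vertex receives none and a special one at most one, which is an obstruction. -/
theorem exists_satisfiesConstraint_pair (hN : IsUndirectedBinaryNetwork N) (hr : cycleRank N = 2)
    (hC₁ : IsCycleOf N C₁) (hC₂ : IsCycleOf N C₂) (he : e ∈ N.edgeSet) (hv₁ : v₁ ∈ C₁.verts)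
    (hv₂ : v₂ ∈ C₂.verts) (hne : v₁ ≠ v₂) (hobs : ∀ B, ¬ IsObstruction N e v₁ v₂ B) :
    ∃ D, SatisfiesConstraint N e (desiredIndeg ![v₁, v₂]) D := by
  refine exists_satisfiesConstraint hN he hr ?_ ?_ ?_
  · intro i j hij
    fin_cases i <;> fin_cases j <;> simp_all
  · intro i
    fin_cases i
    · exact hN.ncard_neighborSet hC₁ hv₁
    · exact hN.ncard_neighborSet hC₂ hv₂
  · intro B hB
    by_contra! hc
    refine hobs B ⟨hB, ?_, ?_⟩
    · intro v hv w hvw hw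
      by_contra hn
      have h1 := hc v hv
      rw [desiredIndeg_eq_one (fun h => hn (mem_range_pair.1 h)), Nat.lt_one_iff,
        Set.ncard_eq_zero (Set.toFinite _)] at h1
      exact Set.notMem_empty w (h1 ▸ ⟨hvw, hw⟩)
    · intro v hv w w' hvw hw hvw' hw'
      have h1 := hc v hv
      have h2 : desiredIndeg ![v₁, v₂] v ≤ 2 := by rw [desiredIndeg]; split_ifs <;> omega
      have h3 : {w | N.Adj v w ∧ (s(v, w) = e ∨ w ∉ B)}.ncard ≤ 1 := by omega
      exact (Set.ncard_le_one (Set.toFinite _)).1 h3 w ⟨hvw, hw⟩ w' ⟨hvw', hw'⟩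

/-- A cycle that enters an obstruction passes through both special vertices. -/
theorem IsObstruction.mem_of_cross {B : Set V} (hB : IsObstruction N e v₁ v₂ B) {C : N.Subgraph}
    (hC : IsCycleOf N C) {x y : V} (hx : x ∈ C.verts) (hy : y ∈ C.verts) (hxB : x ∈ B)
    (hyB : y ∉ B) : (v₁ ∈ B ∧ v₁ ∈ C.verts) ∧ v₂ ∈ B ∧ v₂ ∈ C.verts := by
  obtain ⟨v, hv, w, hw, hvw⟩ := hC.exists_cut_edge hx hy hxB hyB
  obtain ⟨v', hv', w', hw', hvw', hne⟩ := cycleSpace_exists_second_cut_edge hC.mem_cycleSpace hv hw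
    (edgeVector_apply_ne_zero.2 hvw)
  rw [edgeVector_apply_ne_zero] at hvw'
  have h1 := hB.eq_or_eq v hv w hvw.adj_sub (Or.inr hw)
  have h2 := hB.eq_or_eq v' hv' w' hvw'.adj_sub (Or.inr hw')
  -- The two crossing edges have different ends in B, since at most one enters at each vertex; hence
  -- these ends are v₁ and v₂.
  have h3 : v' ≠ v := by
    rintro rfl
    exact hne (by rw [hB.unique v' hv' w w' hvw.adj_sub (Or.inr hw) hvw'.adj_sub (Or.inr hw')])
  have h4 := hvw.fst_mem
  have h5 := hvw'.fst_mem
  grind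

/-- Unless e = v₁v₂, an obstruction B misses an end c of e, and c lies on both cycles. Connectedness
puts some vᵢ into B; its cycle runs to c and so crosses, which brings the other special vertex into
B, and the other cycle crosses too. Then both cycles contain both special vertices. -/
theorem exists_satisfiesConstraint_of_common_edge (hN : IsUndirectedBinaryNetwork N)
    (hr : cycleRank N = 2) (hC₁ : IsCycleOf N C₁) (hC₂ : IsCycleOf N C₂) (he₁ : e ∈ C₁.edgeSet)
    (he₂ : e ∈ C₂.edgeSet) (hv₁ : v₁ ∈ C₁.verts) (hv₂ : v₂ ∈ C₂.verts) (hne : v₁ ≠ v₂)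
    (hnot : ¬ (v₁ ∈ C₂.verts ∧ v₂ ∈ C₁.verts)) :
    ∃ D, SatisfiesConstraint N e (desiredIndeg ![v₁, v₂]) D := by
  have he := C₁.edgeSet_subset he₁
  refine exists_satisfiesConstraint_pair hN hr hC₁ hC₂ he hv₁ hv₂ hne fun B hB => hnot ?_
  by_cases hev : e = s(v₁, v₂)
  · exact ⟨C₂.mem_verts_of_mem_edge he₂ (hev ▸ Sym2.mem_mk_left _ _),
      C₁.mem_verts_of_mem_edge he₁ (hev ▸ Sym2.mem_mk_right _ _)⟩
  · obtain ⟨c, hce, hcB⟩ := hB.exists_notMem he hev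
    have hc₁ := C₁.mem_verts_of_mem_edge he₁ hce
    have hc₂ := C₂.mem_verts_of_mem_edge he₂ hce
    rcases hB.exists_mem hN.connected hcB with h | h
    · have h1 := hB.mem_of_cross hC₁ hv₁ hc₁ h hcB
      have h2 := hB.mem_of_cross hC₂ hv₂ hc₂ h1.2.1 hcB
      exact ⟨h2.1.2, h1.2.2⟩
    · have h1 := hB.mem_of_cross hC₂ hv₂ hc₂ h hcB
      have h2 := hB.mem_of_cross hC₁ hv₁ hc₁ h1.1.1 hcB
      exact ⟨h1.1.2, h2.2.2⟩

/-- Neither cycle can cross the boundary of an obstruction B, as it would contain both special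
vertices. Since C₁ has an end of e outside B, v₁ lies outside; then v₂ and its neighbour w on C₂ lie
inside. Now B can be entered only at v₂, so a shortest walk from v₁ to w passes through v₂ and w is
farther away than v₂, against `hmax`. -/
theorem exists_satisfiesConstraint_of_disjoint (hN : IsUndirectedBinaryNetwork N)
    (hr : cycleRank N = 2) (hC₁ : IsCycleOf N C₁) (hC₂ : IsCycleOf N C₂)
    (hd : Disjoint C₁.verts C₂.verts) (he : e ∈ C₁.edgeSet) (hv₁ : v₁ ∈ C₁.verts)
    (hv₂ : v₂ ∈ C₂.verts) (hmax : ∀ w ∈ C₂.verts, N.dist v₁ w ≤ N.dist v₁ v₂) :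
    ∃ D, SatisfiesConstraint N e (desiredIndeg ![v₁, v₂]) D := by
  classical
  have heN := C₁.edgeSet_subset he
  have hv₂' : v₂ ∉ C₁.verts := fun h => Set.disjoint_left.1 hd h hv₂
  have hv₁' : v₁ ∉ C₂.verts := fun h => Set.disjoint_left.1 hd hv₁ h
  refine exists_satisfiesConstraint_pair hN hr hC₁ hC₂ heN hv₁ hv₂
    (fun h => hv₂' (h ▸ hv₁)) fun B hB => ?_
  obtain ⟨c, hce, hcB⟩ := hB.exists_notMem heN fun h =>
    hv₂' (C₁.mem_verts_of_mem_edge he (h ▸ Sym2.mem_mk_right _ _))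
  have hc₁ := C₁.mem_verts_of_mem_edge he hce
  have hv₁B : v₁ ∉ B := fun h => hv₂' (hB.mem_of_cross hC₁ hv₁ hc₁ h hcB).2.2
  have hv₂B : v₂ ∈ B := (hB.exists_mem hN.connected hcB).resolve_left hv₁B
  obtain ⟨w, hw⟩ := hC₂.exists_adj hv₂
  have hwB : w ∈ B := by
    by_contra h
    exact hv₁' (hB.mem_of_cross hC₂ hv₂ hw.snd_mem hv₂B h).1.2
  obtain ⟨p, hp⟩ := hN.connected.exists_walk_length_eq_dist v₁ w
  obtain ⟨d, hd, h1, h2⟩ := p.exists_boundary_dart Bᶜ hv₁B (by simpa using hwB)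
  have hdB : d.snd ∈ B := by simpa using h2
  have hsnd : d.snd = v₂ := by
    rcases hB.eq_or_eq _ hdB _ d.adj.symm (Or.inr h1) with h | h
    · exact absurd (h ▸ hdB) hv₁B
    · exact h
  have hmem : v₂ ∈ p.support := hsnd ▸ p.dart_snd_mem_support_of_mem_darts hd
  have h3 := congrArg Walk.length (p.take_spec hmem)
  rw [Walk.length_append] at h3
  have h4 := N.dist_le (p.takeUntil v₂ hmem)
  have h5 : (p.dropUntil v₂ hmem).length ≠ 0 := fun h =>
    hw.adj_sub.ne (Walk.eq_of_length_eq_zero h)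
  have h6 := hmax w hw.snd_mem
  omega

/-- Two reticulations that are not adjacent and have no common parent in `V` pass the test. -/
theorem passesTest_of_forall_parent {D : Digraph (Option V)}
    (hD : SatisfiesConstraint N e (desiredIndeg ![v₁, v₂]) D) (hne : v₁ ≠ v₂)
    (hadj : ¬ N.Adj v₁ v₂)
    (hpar : ∀ u, ¬ (D.Adj (some u) (some v₁) ∧ D.Adj (some u) (some v₂))) : PassesTest D := by
  rintro ⟨a, ⟨b, hab⟩, hall⟩
  have hsub : {w | D.Adj a w} ⊆ {some v₁, some v₂} := by
    intro w hw
    cases w with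
    | none => exact absurd hw (hD.1.not_adj_none _)
    | some w =>
      have := hD.isReticulation_iff.1 (hall _ hw)
      simpa using mem_range_pair.1 this
  -- The only reticulations are v₁ and v₂, so a failing vertex with two children has exactly these.
  have hboth : outdeg D a = 2 → D.Adj a (some v₁) ∧ D.Adj a (some v₂) := by
    intro h
    have heq := Set.eq_of_subset_of_ncard_le hsub
      (by rw [Set.ncard_pair (by simpa using hne)]; exact h.ge) (Set.toFinite _)
    constructor
    · have : some v₁ ∈ {w | D.Adj a w} := heq ▸ by simp
      exact this
    · have : some v₂ ∈ {w | D.Adj a w} := heq ▸ by simp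
      exact this
  have harc : ∀ x y, D.Adj (some x) (some y) → N.Adj x y := fun x y h =>
    (insertRoot_adj_some_some.1 (hD.1.adj_iff.2 (Or.inl h))).1
  -- If the root fails, the root edge is v₁v₂; if a tree vertex fails, it is a common parent; if a
  -- reticulation fails, v₁ and v₂ are adjacent or it has a loop.
  cases a with
  | none =>
    obtain ⟨h1, h2⟩ := hboth hD.1.2.2.1.2
    have h3 := insertRoot_adj_none_some.1 (hD.1.adj_iff.2 (Or.inl h1))
    have h4 := insertRoot_adj_none_some.1 (hD.1.adj_iff.2 (Or.inl h2))
    have h5 := (Sym2.mem_and_mem_iff hne).1 ⟨h3, h4⟩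
    have h6 := hD.1.1
    rw [h5] at h6
    exact hadj h6
  | some u =>
    rcases hD.1.vertex_types u with h | h | h
    · exact hpar u (hboth h.2)
    · have hu := hD.isReticulation_iff.1 h
      have hu' := mem_range_pair.1 hu
      have hb := hsub hab
      rcases hu' with rfl | rfl <;> rcases hb with rfl | rfl
      · exact hD.1.2.1.acyclic.not_adj_self _ hab
      · exact hadj (harc _ _ hab)
      · exact hadj (harc _ _ hab).symm
      · exact hD.1.2.1.acyclic.not_adj_self _ hab
    · exact (outdeg_pos hab).ne' h.2

theorem passesTest_of_three_le_dist {D : Digraph (Option V)}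
    (hD : SatisfiesConstraint N e (desiredIndeg ![v₁, v₂]) D) (hdist : 3 ≤ N.dist v₁ v₂) :
    PassesTest D := by
  have hle : ∀ p : N.Walk v₁ v₂, 3 ≤ p.length := fun p => hdist.trans (N.dist_le p)
  have harc : ∀ x y, D.Adj (some x) (some y) → N.Adj x y := fun x y h =>
    (insertRoot_adj_some_some.1 (hD.1.adj_iff.2 (Or.inl h))).1
  refine passesTest_of_forall_parent hD ?_ ?_ ?_
  · rintro rfl
    simp at hdist
  · intro h
    have := hle (Walk.cons h Walk.nil)
    simp at this
  · rintro u ⟨h1, h2⟩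
    have := hle (Walk.cons (harc _ _ h1).symm (Walk.cons (harc _ _ h2) Walk.nil))
    simp at this

end RankTwo

/-! ### Cycle bases of two cycles -/

section PairBasis

variable {V : Type*} {N : SimpleGraph V} {C₁ C₂ : N.Subgraph}

theorem linearIndependent_pair {x y : Sym2 V → ZMod 2} (hx : x ≠ 0) (hy : y ≠ 0) (hxy : x ≠ y) :
    LinearIndependent (ZMod 2) ![x, y] := by
  rw [LinearIndependent.pair_iff]
  intro a b hab
  by_cases ha : a = 0 <;> by_cases hb : b = 0
  · exact ⟨ha, hb⟩
  · rw [ha, zmod_two_eq_one hb] at hab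
    simp [hy] at hab
  · rw [hb, zmod_two_eq_one ha] at hab
    simp [hx] at hab
  · rw [zmod_two_eq_one ha, zmod_two_eq_one hb, one_smul, one_smul] at hab
    exact absurd (funext fun f => CharTwo.add_eq_zero.1 (congrFun hab f)) hxy

theorem edgeVector_pair (C₁ C₂ : N.Subgraph) :
    (fun i => edgeVector (![C₁, C₂] i)) = ![edgeVector C₁, edgeVector C₂] := by
  funext i
  fin_cases i <;> rfl

open Classical in
/-- The vector of a walk is a sum of the vectors of the triangles that it spans with paths from a
fixed vertex. -/
theorem walkVector_mem_of_forall_dart (P : Submodule (ZMod 2) (Sym2 V → ZMod 2))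
    (y : V → Sym2 V → ZMod 2) {u w : V} (p : N.Walk u w)
    (h : ∀ d ∈ p.darts, y d.fst + Pi.single d.edge 1 + y d.snd ∈ P) :
    y u + walkVector p + y w ∈ P := by
  induction p with
  | nil =>
    rw [walkVector_nil, add_zero]
    convert P.zero_mem
    funext f
    exact CharTwo.add_self_eq_zero _
  | @cons u v w hadj p ih =>
    have h1 := h ⟨(u, v), hadj⟩ (by simp)
    have h2 := ih fun d hd => h d (by simp [hd])
    have h3 := P.add_mem h1 h2
    rw [walkVector_cons]
    convert h3 using 1
    funext f
    have h4 := CharTwo.add_self_eq_zero (y v f)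
    simp only [Pi.add_apply, Dart.edge_mk]
    linear_combination -h4

variable [Fintype V]

/-- Two distinct nonzero vectors over 𝔽₂ are independent, and the dimension is at most 2. -/
theorem isCycleBasis_pair (hN : N.Connected) (hr : cycleRank N ≤ 2) (hC₁ : IsCycleOf N C₁)
    (hC₂ : IsCycleOf N C₂) (hne : edgeVector C₁ ≠ edgeVector C₂) : IsCycleBasis ![C₁, C₂] := by
  have hli := linearIndependent_pair hC₁.edgeVector_ne_zero hC₂.edgeVector_ne_zero hne
  refine ⟨fun i => ?_, by rwa [edgeVector_pair], ?_⟩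
  · fin_cases i
    · exact hC₁
    · exact hC₂
  · rw [edgeVector_pair]
    apply Submodule.eq_of_le_of_finrank_le
    · rw [Submodule.span_le]
      rintro _ ⟨i, rfl⟩
      fin_cases i
      · exact hC₁.mem_cycleSpace
      · exact hC₂.mem_cycleSpace
    · rw [finrank_cycleSpace hN, finrank_span_eq_card hli]
      simpa using hr

theorem cycleRank_eq_two (hN : N.Connected) (hr : cycleRank N ≤ 2) (hC₁ : IsCycleOf N C₁)
    (hC₂ : IsCycleOf N C₂) (hne : edgeVector C₁ ≠ edgeVector C₂) : cycleRank N = 2 := by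
  have h := isCycleBasis_pair hN hr hC₁ hC₂ hne
  rw [← finrank_cycleSpace hN, ← h.span_eq, finrank_span_eq_card h.linearIndependent,
    Fintype.card_fin]

theorem IsCycleBasis.edgeVector_ne (h : IsCycleBasis ![C₁, C₂]) :
    edgeVector C₁ ≠ edgeVector C₂ := by
  intro hc
  have := h.linearIndependent.injective (a₁ := 0) (a₂ := 1) hc
  simp at this

theorem IsCycleBasis.eq_or_eq (h : IsCycleBasis ![C₁, C₂]) {z : Sym2 V → ZMod 2}
    (hz : z ∈ cycleSpace N) : z = 0 ∨ z = edgeVector C₁ ∨ z = edgeVector C₂ ∨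
      z = edgeVector C₁ + edgeVector C₂ := by
  rw [← h.span_eq, edgeVector_pair, Matrix.range_cons, Matrix.range_cons, Matrix.range_empty,
    Set.union_empty, Set.singleton_union, Submodule.mem_span_pair] at hz
  obtain ⟨a, b, rfl⟩ := hz
  by_cases ha : a = 0 <;> by_cases hb : b = 0
  · simp [ha, hb]
  · rw [ha, zmod_two_eq_one hb]; simp
  · rw [hb, zmod_two_eq_one ha]; simp
  · rw [zmod_two_eq_one ha, zmod_two_eq_one hb]; simp

theorem IsMinimalCycleBasis.swap (hN : N.Connected) (hr : cycleRank N ≤ 2)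
    (h : IsMinimalCycleBasis ![C₁, C₂]) : IsMinimalCycleBasis ![C₂, C₁] := by
  refine ⟨isCycleBasis_pair hN hr (h.1.isCycle 1) (h.1.isCycle 0) h.1.edgeVector_ne.symm,
    fun C' hC' => ?_⟩
  have := h.2 C' hC'
  simp only [Fin.sum_univ_two, Matrix.cons_val_zero, Matrix.cons_val_one] at this ⊢
  omega

/-- Exchange property of a minimal cycle basis. -/
theorem IsMinimalCycleBasis.length_le (hN : N.Connected) (hr : cycleRank N ≤ 2)
    (h : IsMinimalCycleBasis ![C₁, C₂]) {z : Sym2 V → ZMod 2} (hz : z ∈ cycleSpace N)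
    (hz' : z ∉ Submodule.span (ZMod 2) {edgeVector C₁}) :
    length C₂ ≤ (Function.support z).ncard := by
  obtain ⟨C, hC, hsub, hn⟩ := exists_isCycleOf_notMem _ z hz hz'
  -- The cycle found in the support of z may replace C₂ in the basis.
  have hb := isCycleBasis_pair hN hr (h.1.isCycle 0) hC fun hc =>
    hn (hc ▸ Submodule.mem_span_singleton_self _)
  have h1 := h.2 _ hb
  simp only [Fin.sum_univ_two, Matrix.cons_val_zero, Matrix.cons_val_one] at h1
  have h2 : length C ≤ (Function.support z).ncard := Set.ncard_le_ncard hsub (Set.toFinite _)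
  omega

/-- A cycle of a minimal cycle basis has a vertex that is far away from a given vertex. -/
theorem IsMinimalCycleBasis.exists_length_le_dist (hN : N.Connected) (hr : cycleRank N ≤ 2)
    (h : IsMinimalCycleBasis ![C₁, C₂]) (v : V) :
    ∃ t ∈ C₂.verts, length C₂ ≤ 2 * N.dist v t + 1 := by
  classical
  choose q hq using fun t => hN.exists_walk_length_eq_dist v t
  obtain ⟨u, p, hp, hpC⟩ := h.1.isCycle 1
  change p.toSubgraph = C₂ at hpC
  set P := Submodule.span (ZMod 2) {edgeVector C₁}
  have hnot : edgeVector C₂ ∉ P := by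
    intro hc
    obtain ⟨a, ha⟩ := Submodule.mem_span_singleton.1 hc
    by_cases h0 : a = 0
    · rw [h0, zero_smul] at ha
      exact (h.1.isCycle 1).edgeVector_ne_zero ha.symm
    · rw [zmod_two_eq_one h0, one_smul] at ha
      exact h.1.edgeVector_ne ha
  -- C₂ is the sum, over its edges, of the closed walks formed by that edge and shortest walks from
  -- v to its ends. As C₂ is outside the span of C₁, so is one of these.
  obtain ⟨d, hd, hdP⟩ : ∃ d ∈ p.darts,
      walkVector (q d.fst) + Pi.single d.edge 1 + walkVector (q d.snd) ∉ P := by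
    by_contra! hc
    have h1 := walkVector_mem_of_forall_dart P (fun t => walkVector (q t)) p hc
    apply hnot
    rw [walkVector_eq_edgeVector hp.isTrail, hpC] at h1
    convert h1 using 1
    funext f
    have h4 := CharTwo.add_self_eq_zero (walkVector (q u) f)
    simp only [Pi.add_apply]
    linear_combination -h4
  let W : N.Walk v v := (q d.fst).append (Walk.cons d.adj (q d.snd).reverse)
  have hW : walkVector W = walkVector (q d.fst) + Pi.single d.edge 1 + walkVector (q d.snd) := by
    rw [walkVector_append, walkVector_cons, walkVector_reverse, add_assoc]
    rfl
  -- Exchange bounds the length of C₂ by the two distances plus 1; the farther end of the edge is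
  -- the required vertex.
  have h1 := h.length_le hN hr (walkVector_mem_cycleSpace W) (hW ▸ hdP)
  have h2 := ncard_support_walkVector_le W
  have h3 : W.length = N.dist v d.fst + (N.dist v d.snd + 1) := by
    simp [W, hq]
  have hf : d.fst ∈ C₂.verts := by
    rw [← hpC, Walk.mem_verts_toSubgraph]
    exact p.dart_fst_mem_support_of_mem_darts hd
  have hs : d.snd ∈ C₂.verts := by
    rw [← hpC, Walk.mem_verts_toSubgraph]
    exact p.dart_snd_mem_support_of_mem_darts hd
  rcases le_total (N.dist v d.fst) (N.dist v d.snd) with hle | hle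
  · exact ⟨_, hs, by omega⟩
  · exact ⟨_, hf, by omega⟩

/-- The two cycles of a cycle basis do not have the same vertices. -/
theorem IsCycleBasis.verts_ne (h : IsCycleBasis ![C₁, C₂]) : C₁.verts ≠ C₂.verts := by
  classical
  intro hv
  have hC₁ : IsCycleOf N C₁ := h.isCycle 0
  have hC₂ : IsCycleOf N C₂ := h.isCycle 1
  -- With equal vertex sets but different edges, C₁ has an edge uv that is a chord of C₂.
  obtain ⟨u, v, huv, hnot⟩ : ∃ u v, C₁.Adj u v ∧ ¬ C₂.Adj u v := by
    by_contra! hc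
    apply h.edgeVector_ne
    have hadj : ∀ u v, C₁.Adj u v ↔ C₂.Adj u v := by
      refine fun u v => ⟨hc u v, fun h2 => ?_⟩
      have hu := h2.fst_mem
      have heq := Set.eq_of_subset_of_ncard_le (s := C₁.neighborSet u) (t := C₂.neighborSet u)
        (fun w hw => hc u w hw)
        (by rw [hC₁.ncard_neighborSet (hv ▸ hu), hC₂.ncard_neighborSet hu]) (Set.toFinite _)
      have : v ∈ C₁.neighborSet u := heq ▸ h2
      exact this
    have hes : C₁.edgeSet = C₂.edgeSet := by
      ext f
      induction f with | h a b
      exact hadj a b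
    rw [edgeVector, edgeVector, hes]
  have huC : u ∈ C₂.verts := hv ▸ huv.fst_mem
  have hvC : v ∈ C₂.verts := hv ▸ huv.snd_mem
  obtain ⟨p, hp, hpC⟩ := hC₂.exists_isCycle huC
  have hvp : v ∈ p.support := by rwa [← hpC, Walk.mem_verts_toSubgraph] at hvC
  have hlen : length C₁ = p.length := by
    rw [← hC₁.ncard_verts, hv, hC₂.ncard_verts, ← hpC, length_toSubgraph hp]
  obtain ⟨a, b, hab⟩ : ∃ (a : N.Walk u v) (b : N.Walk v u), p = a.append b :=
    ⟨_, _, (p.take_spec hvp).symm⟩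
  have hnp : s(u, v) ∉ p.edges := by
    rw [← Walk.mem_edges_toSubgraph, hpC]; exact hnot
  rw [hab, Walk.edges_append, List.mem_append, not_or] at hnp
  have hvec : walkVector a + walkVector b = edgeVector C₂ := by
    rw [← walkVector_append, ← hab, walkVector_eq_edgeVector hp.isTrail, hpC]
  have hza : walkVector a s(u, v) = 0 := by
    by_contra hc; exact hnp.1 (walkVector_ne_zero hc)
  have hzb : walkVector b s(u, v) = 0 := by
    by_contra hc; exact hnp.2 (walkVector_ne_zero hc)
  -- neither arc consists of a single edge
  have ha2 : 2 ≤ a.length := by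
    cases a with
    | nil => exact absurd rfl huv.adj_sub.ne
    | cons h1 a =>
      cases a with
      | nil => simp at hnp
      | cons h2 a => simp
  have hb2 : 2 ≤ b.length := by
    cases b with
    | nil => exact absurd rfl huv.adj_sub.ne
    | cons h1 b =>
      cases b with
      | nil => simp [Sym2.eq_swap] at hnp
      | cons h2 b => simp
  have hpl : p.length = a.length + b.length := by rw [hab, Walk.length_append]
  -- The chord closes each of the two arcs of C₂. Both arcs have length at least 2, so both closed
  -- walks are shorter than C₂, which is as long as C₁.
  let A : N.Walk u u := a.append (Walk.cons huv.adj_sub.symm Walk.nil)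
  let B : N.Walk v v := b.append (Walk.cons huv.adj_sub Walk.nil)
  have hA : walkVector A = walkVector a + Pi.single s(u, v) 1 := by
    rw [walkVector_append, walkVector_cons, walkVector_nil, add_zero, Sym2.eq_swap]
  have hB : walkVector B = walkVector b + Pi.single s(u, v) 1 := by
    rw [walkVector_append, walkVector_cons, walkVector_nil, add_zero]
  have hA1 : walkVector A s(u, v) = 1 := by simp [hA, hza]
  have hc2 : edgeVector C₂ s(u, v) = 0 := by rw [← hvec, Pi.add_apply, hza, hzb, add_zero]
  have hlenA := ncard_support_walkVector_le A
  have hlenB := ncard_support_walkVector_le B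
  have hAl : A.length = a.length + 1 := by simp [A]
  have hBl : B.length = b.length + 1 := by simp [B]
  have hsupp : (Function.support (edgeVector C₁)).ncard = length C₁ := by
    rw [support_edgeVector]; rfl
  -- A contains the chord, so it is neither 0 nor C₂, and it is too short to be C₁. If A = C₁ + C₂,
  -- then B = A + C₂ = C₁, and B is too short as well.
  rcases h.eq_or_eq (walkVector_mem_cycleSpace A) with h1 | h1 | h1 | h1
  · rw [h1] at hA1; exact absurd hA1 (by simp)
  · rw [h1, hsupp] at hlenA; omega
  · rw [h1, hc2] at hA1; exact absurd hA1 (by simp)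
  · have h2 : walkVector B = edgeVector C₁ := by
      funext f
      have h3 := congrFun h1 f
      have h4 := congrFun hvec f
      have h5 := CharTwo.add_self_eq_zero (walkVector a f)
      have h6 := CharTwo.add_self_eq_zero (edgeVector C₂ f)
      rw [hA] at h3
      rw [hB]
      simp only [Pi.add_apply] at h3 h4 ⊢
      linear_combination h3 + h4 - h5 + h6
    rw [h2, hsupp] at hlenB
    omega

end PairBasis

/-! ### Optimal placements -/

section Placements

variable {V : Type*} {N : SimpleGraph V}

theorem mem_verts_of_edgeVector_ne_zero {C : N.Subgraph} {v w : V}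
    (h : edgeVector C s(v, w) ≠ 0) : v ∈ C.verts :=
  (edgeVector_apply_ne_zero.1 h).fst_mem

theorem distanceSum_pair (s : Fin 2 → V) : distanceSum N s = N.dist (s 0) (s 1) := by
  have h0 : Finset.Ioi (0 : Fin 2) = {1} := by decide
  have h1 : Finset.Ioi (1 : Fin 2) = ∅ := by decide
  simp [distanceSum, h0, h1]

theorem placements_pair {C : Fin 2 → N.Subgraph} {v w : V} (hv : v ∈ (C 0).verts)
    (hw : w ∈ (C 1).verts) (h : 2 ≤ N.dist v w) : ![v, w] ∈ placements C := by
  refine ⟨fun i => ?_, fun i j hij => ?_⟩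
  · fin_cases i
    · exact hv
    · exact hw
  · fin_cases i <;> fin_cases j
    · exact absurd hij (lt_irrefl _)
    · exact h
    · exact absurd hij (by decide)
    · exact absurd hij (lt_irrefl _)

variable [Fintype V]

/-- The reticulations of a tree-child orientation form a placement. -/
theorem exists_placement_of_isTreeChild (hN : N.Connected) {n : ℕ} (hn : cycleRank N = n)
    (hn2 : n ≤ 2) {C : Fin n → N.Subgraph} (hC : IsCycleBasis C) {e : Sym2 V}
    {D : Digraph (Option V)} (hD : IsOrientationAt N e D) (ht : IsTreeChild D) :
    ∃ s ∈ placements C, Set.range s = {v | IsReticulation D (some v)} := by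
  have hcard := hD.ncard_reticulations hN
  rw [hn] at hcard
  interval_cases n
  · rw [Set.ncard_eq_zero (Set.toFinite _)] at hcard
    exact ⟨Fin.elim0, ⟨fun i => i.elim0, fun i => i.elim0⟩, by rw [hcard]; simp⟩
  · obtain ⟨v, hv, ⟨w, hw⟩, -⟩ := hD.exists_sink (hC.isCycle 0).mem_cycleSpace
      (hC.isCycle 0).edgeVector_ne_zero
    refine ⟨fun _ => v, ⟨fun i => ?_, fun i j hij => ?_⟩, ?_⟩
    · rw [Subsingleton.elim i 0]
      exact mem_verts_of_edgeVector_ne_zero hw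
    · exact absurd (Subsingleton.elim i j) hij.ne
    · obtain ⟨x, hx⟩ := Set.ncard_eq_one.1 hcard
      have hvx : v ∈ ({x} : Set V) := hx ▸ hv
      rw [hx, Set.mem_singleton_iff.1 hvx, Set.range_const]
  · obtain ⟨x, y, hxy, hx, hy, ⟨w, hw⟩, w', hw'⟩ := hD.exists_reticulation_pair
      (hC.isCycle 0).mem_cycleSpace (hC.isCycle 1).mem_cycleSpace (hC.isCycle 0).edgeVector_ne_zero
      (hC.isCycle 1).edgeVector_ne_zero
      (fun h => absurd (hC.linearIndependent.injective h) (by simp))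
    refine ⟨![x, y], ⟨fun i => ?_, fun i j hij => ?_⟩, ?_⟩
    · fin_cases i
      · exact mem_verts_of_edgeVector_ne_zero hw
      · exact mem_verts_of_edgeVector_ne_zero hw'
    · fin_cases i <;> fin_cases j
      · exact absurd hij (lt_irrefl _)
      · exact hD.two_le_dist hN ht hxy hx hy
      · exact absurd hij (by decide)
      · exact absurd hij (lt_irrefl _)
    · apply Set.eq_of_subset_of_ncard_le
      · intro v hv
        rcases mem_range_pair.1 hv with rfl | rfl
        · exact hx
        · exact hy
      · rw [hcard, show Set.range ![x, y] = {x, y} from Set.ext fun v => mem_range_pair,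
          Set.ncard_pair hxy]
      · exact Set.toFinite _

theorem exists_mem_optimalPlacements {n : ℕ} {C : Fin n → N.Subgraph}
    (h : (placements C).Nonempty) : (optimalPlacements C).Nonempty := by
  obtain ⟨s, hs, hmax⟩ := Set.exists_max_image (placements C) (distanceSum N) (Set.toFinite _) h
  exact ⟨s, hs, hmax⟩

/-- If there are placements of two reticulations, some optimal one has a constrained orientation. -/
theorem exists_optimalPlacement_satisfiesConstraint (hN : IsUndirectedBinaryNetwork N)
    (hr : cycleRank N = 2) {C : Fin 2 → N.Subgraph} (hC : IsMinimalCycleBasis C) {s : Fin 2 → V}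
    (hs : s ∈ optimalPlacements C) :
    ∃ t ∈ optimalPlacements C, ∃ e ∈ N.edgeSet, ∃ D,
      SatisfiesConstraint N e (desiredIndeg t) D := by
  have heta : ∀ t : Fin 2 → V, ![t 0, t 1] = t := fun t => by
    funext i; fin_cases i <;> rfl
  have hCeta : ![C 0, C 1] = C := by funext i; fin_cases i <;> rfl
  have hC' : IsMinimalCycleBasis ![C 0, C 1] := hCeta ▸ hC
  have hC₀ := hC.1.isCycle 0
  have hC₁ := hC.1.isCycle 1
  have h2 := hs.1.2 0 1 (by decide)
  by_cases hsh : ∃ e, e ∈ (C 0).edgeSet ∧ e ∈ (C 1).edgeSet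
  · obtain ⟨e, he₀, he₁⟩ := hsh
    -- it suffices to find an optimal placement that is not contained in both cycles
    suffices H : ∃ t ∈ optimalPlacements C, ¬ (t 0 ∈ (C 1).verts ∧ t 1 ∈ (C 0).verts) by
      obtain ⟨t, ht, hnot⟩ := H
      have hd := ht.1.2 0 1 (by decide)
      obtain ⟨D, hD⟩ := exists_satisfiesConstraint_of_common_edge hN hr hC₀ hC₁ he₀ he₁
        (ht.1.1 0) (ht.1.1 1) (fun h => by rw [h] at hd; simp at hd) hnot
      exact ⟨t, ht, e, (C 0).edgeSet_subset he₀, D, heta t ▸ hD⟩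
    by_cases hnot : s 0 ∈ (C 1).verts ∧ s 1 ∈ (C 0).verts
    -- Both entries lie on both cycles, so a replacement at least as far apart is needed, with one
    -- entry on just one cycle.
    · have hopt : ∀ v w, v ∈ (C 0).verts → w ∈ (C 1).verts →
          N.dist (s 0) (s 1) ≤ N.dist v w → ![v, w] ∈ optimalPlacements C := by
        intro v w hv hw hd
        refine ⟨placements_pair hv hw (h2.trans hd), fun t ht => (hs.2 t ht).trans ?_⟩
        simpa [distanceSum_pair] using hd
      rcases not_and_or.1 (fun h : (C 0).verts ⊆ (C 1).verts ∧ (C 1).verts ⊆ (C 0).verts =>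
        hC'.1.verts_ne (h.1.antisymm h.2)) with h | h
      · obtain ⟨v, hv, hv'⟩ := Set.not_subset.1 h
        obtain ⟨t, ht, hle⟩ := hC'.exists_length_le_dist hN.connected hr.le v
        -- Both entries lie on `C 1`, so 2·d(s 0, s 1) ≤ length ≤ 2·d(v, t) + 1, and integrality
        -- gives d(s 0, s 1) ≤ d(v, t).
        have h3 := hC₁.two_mul_dist_le hnot.1 (hs.1.1 1)
        exact ⟨_, hopt v t hv ht (by omega), fun h => hv' h.1⟩
      · obtain ⟨v, hv, hv'⟩ := Set.not_subset.1 h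
        obtain ⟨t, ht, hle⟩ :=
          (hC'.swap hN.connected hr.le).exists_length_le_dist hN.connected hr.le v
        have h3 := hC₀.two_mul_dist_le (hs.1.1 0) hnot.2
        rw [N.dist_comm] at hle
        exact ⟨_, hopt t v ht hv (by omega), fun h => hv' h.2⟩
    · exact ⟨s, hs, hnot⟩
  · have hd : Disjoint (C 0).verts (C 1).verts := by
      rw [Set.disjoint_left]
      intro v hv hv'
      obtain ⟨w, hw, hw'⟩ := hN.exists_common_adj hC₀ hC₁ hv hv'
      exact hsh ⟨s(v, w), hw, hw'⟩
    obtain ⟨e, he⟩ := hC₀.edgeSet_nonempty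
    obtain ⟨D, hD⟩ := exists_satisfiesConstraint_of_disjoint hN hr hC₀ hC₁ hd he (hs.1.1 0)
      (hs.1.1 1) (by
        intro w hw
        -- A vertex w at distance at least 2 gives a competing placement; a closer one is below the
        -- distance of s anyway.
        by_cases h : 2 ≤ N.dist (s 0) w
        · have := hs.2 _ (placements_pair (hs.1.1 0) hw h)
          simpa [distanceSum_pair] using this
        · omega)
    exact ⟨s, hs, e, (C 0).edgeSet_subset he, D, heta s ▸ hD⟩

/-- If the network is tree-child orientable, then for some optimal placement and some root edge
the constrained orientation exists and passes the test. -/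
theorem exists_optimalPlacement_passesTest (hN : IsUndirectedBinaryNetwork N) {n : ℕ}
    (hn : cycleRank N = n) (hn2 : n ≤ 2) {C : Fin n → N.Subgraph} (hC : IsMinimalCycleBasis C)
    (ho : IsTreeChildOrientable N) :
    ∃ s ∈ optimalPlacements C, ∃ e ∈ N.edgeSet,
      (∃ D, SatisfiesConstraint N e (desiredIndeg s) D) ∧
      ∀ D, SatisfiesConstraint N e (desiredIndeg s) D → PassesTest D := by
  obtain ⟨D, ⟨e, hD⟩, ht⟩ := ho
  obtain ⟨s, hs, hrange⟩ := exists_placement_of_isTreeChild hN.connected hn hn2 hC.1 hD ht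
  by_cases hopt : s ∈ optimalPlacements C
  · have hDc := hD.satisfiesConstraint hrange
    refine ⟨s, hopt, e, hD.1, ⟨D, hDc⟩, fun D' hD' => ?_⟩
    rw [hD'.unique hDc]
    exact hD.2.1.passesTest_iff.2 ht
  · obtain ⟨t, ht, hlt⟩ : ∃ t ∈ placements C, distanceSum N s < distanceSum N t := by
      by_contra! hc
      exact hopt ⟨hs, hc⟩
    -- For n ≤ 1 the objective is identically 0, so every placement is optimal.
    obtain rfl : n = 2 := by
      interval_cases n
      · simp [distanceSum] at hlt
      · simp [distanceSum] at hlt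
      · rfl
    obtain ⟨x, hx⟩ := exists_mem_optimalPlacements ⟨s, hs⟩
    obtain ⟨y, hy, f, hf, hDy⟩ := exists_optimalPlacement_satisfiesConstraint hN hn hC hx
    refine ⟨y, hy, f, hf, hDy, fun D' hD' => ?_⟩
    -- The non-optimal s already has distance at least 2, so the optimal one has at least 3 and any
    -- constrained orientation passes.
    have h1 := hy.2 t ht
    have h2 := hs.2 0 1 (by decide)
    rw [distanceSum_pair, distanceSum_pair] at h1 hlt
    have heta : y = ![y 0, y 1] := by funext i; fin_cases i <;> rfl
    rw [heta] at hD'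
    exact passesTest_of_three_le_dist hD' (by omega)

end Placements

/-! ### Runs of the algorithm -/

section Runs

variable {V : Type*}

theorem edgeLoop_eq_some {solve : Sym2 V → Option (Digraph (Option V))} {es : List (Sym2 V)}
    {D : Digraph (Option V)} (h : edgeLoop solve es = some D) :
    ∃ e ∈ es, solve e = some D ∧ PassesTest D := by
  induction es with
  | nil => simp [edgeLoop] at h
  | cons e es ih =>
    rw [edgeLoop] at h
    split at h
    · rename_i D' hD'
      split_ifs at h with hp
      · rw [Option.some.injEq] at h
        subst h
        exact ⟨e, by simp, hD', hp⟩
      · obtain ⟨f, hf, hf'⟩ := ih h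
        exact ⟨f, by simp [hf], hf'⟩
    · obtain ⟨f, hf, hf'⟩ := ih h
      exact ⟨f, by simp [hf], hf'⟩

theorem edgeLoop_eq_none {solve : Sym2 V → Option (Digraph (Option V))} {es : List (Sym2 V)}
    (h : edgeLoop solve es = none) {e : Sym2 V} (he : e ∈ es) {D : Digraph (Option V)}
    (hD : solve e = some D) : ¬ PassesTest D := by
  induction es with
  | nil => simp at he
  | cons f es ih =>
    rw [edgeLoop] at h
    rcases List.mem_cons.1 he with rfl | he
    · rw [hD] at h
      intro hp
      simp [hp] at h
    · split at h
      · split_ifs at h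
        exact ih h he
      · exact ih h he

variable {n : ℕ} {solve : Sym2 V → (V → ℕ) → Option (Digraph (Option V))}
  {order : (Fin n → V) → List (Sym2 V)} {ss : List (Fin n → V)}

theorem placementLoop_eq_some {D : Digraph (Option V)}
    (h : placementLoop solve order ss = some D) :
    ∃ s ∈ ss, ∃ e ∈ order s, solve e (desiredIndeg s) = some D ∧ PassesTest D := by
  induction ss with
  | nil => simp [placementLoop] at h
  | cons s ss ih =>
    rw [placementLoop] at h
    split at h
    · rename_i D' hD'
      rw [Option.some.injEq] at h
      subst h
      obtain ⟨e, he, h'⟩ := edgeLoop_eq_some hD'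
      exact ⟨s, by simp, e, he, h'⟩
    · obtain ⟨t, ht, ht'⟩ := ih h
      exact ⟨t, by simp [ht], ht'⟩

theorem placementLoop_eq_none (h : placementLoop solve order ss = none) {s : Fin n → V}
    (hs : s ∈ ss) : edgeLoop (fun e => solve e (desiredIndeg s)) (order s) = none := by
  induction ss with
  | nil => simp at hs
  | cons t ss ih =>
    rw [placementLoop] at h
    split at h
    · simp at h
    · rename_i hnone
      rcases List.mem_cons.1 hs with rfl | hs
      · exact hnone
      · exact ih h hs

variable [Fintype V] {N : SimpleGraph V}

theorem exists_isConstrainedAnswer (N : SimpleGraph V) (e : Sym2 V) (δ : V → ℕ) :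
    ∃ o, IsConstrainedAnswer N e δ o := by
  by_cases h : ∃ D, SatisfiesConstraint N e δ D
  · obtain ⟨D, hD⟩ := h
    exact ⟨some D, hD⟩
  · exact ⟨none, h⟩

theorem exists_heuristicReturns (hN : N.Connected) : ∃ o, HeuristicReturns N o := by
  classical
  obtain ⟨C, hC⟩ := exists_isMinimalCycleBasis hN
  choose solve hsolve using exists_isConstrainedAnswer N
  exact ⟨_, C, (optimalPlacements C).toFinset.toList, fun _ => N.edgeSet.toFinset.toList, solve, hC,
    ⟨Finset.nodup_toList _, by simp⟩, fun _ => ⟨Finset.nodup_toList _, by simp⟩,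
    fun e _ δ => hsolve e δ, rfl⟩

theorem HeuristicReturns.isTreeChildAnswer (hN : IsUndirectedBinaryNetwork N)
    (hr : cycleRank N ≤ 2) {o : Option (Digraph (Option V))} (ho : HeuristicReturns N o) :
    IsTreeChildAnswer N o := by
  obtain ⟨C, ss, order, solve, hC, ⟨-, hss⟩, horder, hsolve, rfl⟩ := ho
  rcases h : placementLoop solve order ss with _ | D
  · intro htc
    obtain ⟨s, hs, e, he, ⟨D, hD⟩, hpass⟩ := exists_optimalPlacement_passesTest hN rfl hr hC htc
    have hloop := placementLoop_eq_none h ((hss s).2 hs)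
    have hans := hsolve e he (desiredIndeg s)
    rcases hsol : solve e (desiredIndeg s) with _ | D'
    · rw [hsol] at hans
      exact hans ⟨D, hD⟩
    · rw [hsol] at hans
      -- Whichever orientation the solver returned for this placement and edge, it passes the test.
      exact edgeLoop_eq_none hloop (((horder s).2 e).2 he) hsol (hpass D' hans)
  · obtain ⟨s, -, e, he, hsol, hp⟩ := placementLoop_eq_some h
    have hans := hsolve e (((horder s).2 e).1 he) (desiredIndeg s)
    rw [hsol] at hans
    exact ⟨⟨e, hans.1⟩, hans.1.2.1.passesTest_iff.1 hp⟩

end Runs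

/-! ### Cycles that share exactly one edge -/

section CommonEdge

variable {V : Type*} {N : SimpleGraph V} {C₁ C₂ : N.Subgraph}

theorem edgeVector_ne_of_ncard_inter (hC₁ : IsCycleOf N C₁)
    (h : (C₁.edgeSet ∩ C₂.edgeSet).ncard = 1) : edgeVector C₁ ≠ edgeVector C₂ := by
  intro hc
  have heq : C₁.edgeSet = C₂.edgeSet := by
    rw [← support_edgeVector, hc, support_edgeVector]
  have h3 := hC₁.three_le_length
  rw [← heq, Set.inter_self] at h
  rw [length] at h3
  omega

variable [Fintype V]

/-- Common vertices of two cycles that share exactly one edge are ends of that edge. -/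
theorem mem_common_edge (hN : IsUndirectedBinaryNetwork N) (hC₁ : IsCycleOf N C₁)
    (hC₂ : IsCycleOf N C₂) {e : Sym2 V} (he : C₁.edgeSet ∩ C₂.edgeSet = {e}) {v : V}
    (hv₁ : v ∈ C₁.verts) (hv₂ : v ∈ C₂.verts) : v ∈ e := by
  obtain ⟨w, hw₁, hw₂⟩ := hN.exists_common_adj hC₁ hC₂ hv₁ hv₂
  have : s(v, w) ∈ ({e} : Set (Sym2 V)) := he ▸ ⟨hw₁, hw₂⟩
  rw [← Set.mem_singleton_iff.1 this]
  exact Sym2.mem_mk_left v w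

/-- Root at the common edge pq, with reticulations p for C₁ and, for C₂, the neighbour y of q on C₂
other than p. As y is not on C₁, the orientation exists. Adjacency of p and y, or a common parent,
would create a closed walk whose vector is none of the four in the cycle space. -/
theorem isTreeChildOrientable_of_four_le (hN : IsUndirectedBinaryNetwork N) (hr : cycleRank N ≤ 2)
    (hC₁ : IsCycleOf N C₁) (hC₂ : IsCycleOf N C₂) (h : (C₁.edgeSet ∩ C₂.edgeSet).ncard = 1)
    (h4 : 4 ≤ length C₂) : IsTreeChildOrientable N := by
  classical
  have hne := edgeVector_ne_of_ncard_inter hC₁ h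
  have hr2 := cycleRank_eq_two hN.connected hr hC₁ hC₂ hne
  have hbasis := isCycleBasis_pair hN.connected hr hC₁ hC₂ hne
  obtain ⟨e, he⟩ := Set.ncard_eq_one.1 h
  have hee : e ∈ C₁.edgeSet ∩ C₂.edgeSet := he ▸ Set.mem_singleton e
  induction e with | h p q
  have hpq₁ : C₁.Adj p q := hee.1
  have hpq₂ : C₂.Adj p q := hee.2
  have hpq : p ≠ q := hpq₁.adj_sub.ne
  obtain ⟨y, hqy, hyp⟩ : ∃ y, C₂.Adj q y ∧ y ≠ p :=
    Set.exists_ne_of_one_lt_ncard (s := C₂.neighborSet q)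
      (by rw [hC₂.ncard_neighborSet hpq₂.snd_mem]; omega) p
  have hyq : y ≠ q := hqy.adj_sub.ne'
  have hy₁ : y ∉ C₁.verts := by
    intro hc
    have := mem_common_edge hN hC₁ hC₂ he hc hqy.snd_mem
    rw [Sym2.mem_iff] at this
    rcases this with h | h
    · exact hyp h
    · exact hyq h
  have hz₁ : ∀ w, edgeVector C₁ s(y, w) = 0 := by
    intro w
    by_contra hc
    exact hy₁ (mem_verts_of_edgeVector_ne_zero hc)
  obtain ⟨D, hD⟩ := exists_satisfiesConstraint_of_common_edge hN hr2 hC₁ hC₂ hee.1 hee.2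
    hpq₁.fst_mem hqy.snd_mem hyp.symm (fun h => hy₁ h.2)
  have hadj : ¬ N.Adj p y := by
    intro hpy
    let W : N.Walk p p := Walk.cons hpq₁.adj_sub (Walk.cons hqy.adj_sub (Walk.cons hpy.symm Walk.nil))
    have hW : walkVector W = Pi.single s(p, q) 1 + (Pi.single s(q, y) 1 + Pi.single s(y, p) 1) := by
      simp only [W, walkVector_cons, walkVector_nil, add_zero]
    have hWpq : walkVector W s(p, q) = 1 := by
      rw [hW]
      simp [hpq, hyp.symm, hyq.symm]
    have hWyq : walkVector W s(y, q) = 1 := by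
      rw [hW, Sym2.eq_swap (a := q) (b := y)]
      simp [hpq.symm, hyp, hyq]
    have hlen := ncard_support_walkVector_le W
    have hWl : W.length = 3 := rfl
    -- The triangle pqy: its value at pq excludes 0 and C₁ + C₂, its value at yq excludes C₁, and
    -- length at least 4 excludes C₂.
    rcases hbasis.eq_or_eq (walkVector_mem_cycleSpace W) with h1 | h1 | h1 | h1
    · rw [h1] at hWpq
      exact absurd hWpq (by simp)
    · rw [h1, hz₁] at hWyq
      exact absurd hWyq (by simp)
    · rw [h1, support_edgeVector] at hlen
      rw [length] at h4
      omega
    · rw [h1, Pi.add_apply, edgeVector_apply_of_mem hee.1, edgeVector_apply_of_mem hee.2,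
        CharTwo.add_self_eq_zero] at hWpq
      exact absurd hWpq (by simp)
  have hpar : ∀ u, ¬ (D.Adj (some u) (some p) ∧ D.Adj (some u) (some y)) := by
    rintro u ⟨hup, huy⟩
    -- The sink of C₁ is p, since y is not on C₁. Both arcs into p thus come from C₁, one of them
    -- through the root, so u is the other neighbour x of p on C₁.
    obtain ⟨v, hv, ⟨w, hw⟩, hpv⟩ := hD.1.exists_sink hC₁.mem_cycleSpace hC₁.edgeVector_ne_zero
    rcases mem_range_pair.1 (hD.isReticulation_iff.1 hv) with rfl | rfl
    · obtain ⟨x, hx, hxu⟩ := (hpv _).1 hup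
      have hvx : s(v, x) ≠ s(v, q) := by
        intro hc
        rw [via_of_eq hc] at hxu
        simp at hxu
      rw [via_of_ne hvx, Option.some.injEq] at hxu
      subst hxu
      have hxq : x ≠ q := fun hc => hvx (by rw [hc])
      have hvx₁ : C₁.Adj v x := edgeVector_apply_ne_zero.1 hx
      have hxy : N.Adj x y := (insertRoot_adj_some_some.1 (hD.1.adj_iff.2 (Or.inl huy))).1
      have hx₂ : x ∉ C₂.verts := by
        intro hc
        have := mem_common_edge hN hC₁ hC₂ he hvx₁.snd_mem hc
        rw [Sym2.mem_iff] at this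
        rcases this with h | h
        · exact hvx₁.adj_sub.ne h.symm
        · exact hxq h
      have hz₂ : edgeVector C₂ s(y, x) = 0 := by
        by_contra hc
        exact hx₂ (edgeVector_apply_ne_zero.1 hc).snd_mem
      let W : N.Walk v v := Walk.cons hpq₁.adj_sub (Walk.cons hqy.adj_sub
        (Walk.cons hxy.symm (Walk.cons hvx₁.adj_sub.symm Walk.nil)))
      have hW : walkVector W = Pi.single s(v, q) 1 + (Pi.single s(q, y) 1 +
          (Pi.single s(y, x) 1 + Pi.single s(x, v) 1)) := by
        simp only [W, walkVector_cons, walkVector_nil, add_zero]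
      have hWyx : walkVector W s(y, x) = 1 := by
        rw [hW]
        simp [hyp, hyq, hxq, hxy.ne']
      -- The edge yx lies on this closed walk but on neither basic cycle, as y is not on C₁ and x is
      -- not on C₂.
      rcases hbasis.eq_or_eq (walkVector_mem_cycleSpace W) with h1 | h1 | h1 | h1 <;>
        simp [h1, hz₁, hz₂] at hWyx
    · exact hw (hz₁ w)
  exact ⟨D, ⟨_, hD.1⟩, hD.1.2.1.passesTest_iff.1
    (passesTest_of_forall_parent hD hyp.symm hadj hpar)⟩

theorem adj_of_length_eq_three {C : N.Subgraph} (hC : IsCycleOf N C) (h : length C = 3) {v w : V}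
    (hv : v ∈ C.verts) (hw : w ∈ C.verts) (hne : v ≠ w) : C.Adj v w := by
  have hsub : C.neighborSet v ⊆ C.verts \ {v} := fun x hx =>
    ⟨(show C.Adj v x from hx).snd_mem, fun hc => hx.adj_sub.ne hc.symm⟩
  have hcard : (C.verts \ {v}).ncard = 2 := by
    rw [Set.ncard_sdiff_singleton_of_mem hv, hC.ncard_verts, h]
  have heq := Set.eq_of_subset_of_ncard_le hsub (by rw [hcard, hC.ncard_neighborSet hv])
    (Set.toFinite _)
  have : w ∈ C.neighborSet v := heq ▸ ⟨hw, hne.symm⟩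
  exact this

/-- The reticulations a, b represent the two triangles and are not adjacent, so they are the apexes
off the common edge pq. Each of p, q is a parent of both, hence violates the test, unless the root
edge joins it to a or b; one root edge cannot do this for both p and q. -/
theorem not_isTreeChildOrientable_of_triangles (hN : IsUndirectedBinaryNetwork N)
    (hr : cycleRank N ≤ 2) (hC₁ : IsCycleOf N C₁) (hC₂ : IsCycleOf N C₂)
    (h : (C₁.edgeSet ∩ C₂.edgeSet).ncard = 1) (h₁ : length C₁ = 3) (h₂ : length C₂ = 3) :
    ¬ IsTreeChildOrientable N := by
  rintro ⟨D, ⟨f, hD⟩, ht⟩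
  have hne := edgeVector_ne_of_ncard_inter hC₁ h
  have hr2 := cycleRank_eq_two hN.connected hr hC₁ hC₂ hne
  obtain ⟨e, he⟩ := Set.ncard_eq_one.1 h
  have hee : e ∈ C₁.edgeSet ∩ C₂.edgeSet := he ▸ Set.mem_singleton e
  induction e with | h p q
  have hpq₁ : C₁.Adj p q := hee.1
  have hpq₂ : C₂.Adj p q := hee.2
  obtain ⟨a, b, hab, ha, hb, ⟨w, hw⟩, w', hw'⟩ := hD.exists_reticulation_pair
    hC₁.mem_cycleSpace hC₂.mem_cycleSpace hC₁.edgeVector_ne_zero hC₂.edgeVector_ne_zero hne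
  have ha₁ : a ∈ C₁.verts := mem_verts_of_edgeVector_ne_zero hw
  have hb₂ : b ∈ C₂.verts := mem_verts_of_edgeVector_ne_zero hw'
  have hnadj : ¬ N.Adj a b := by
    intro hc
    have h2 := hD.two_le_dist hN.connected ht hab ha hb
    rw [dist_eq_one_iff_adj.2 hc] at h2
    omega
  have ha₂ : a ∉ C₂.verts := fun hc => hnadj (adj_of_length_eq_three hC₂ h₂ hc hb₂ hab).adj_sub
  have hb₁ : b ∉ C₁.verts := fun hc => hnadj (adj_of_length_eq_three hC₁ h₁ ha₁ hc hab).adj_sub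
  have hret : ∀ v, IsReticulation D (some v) → v = a ∨ v = b := by
    have hcard := hD.ncard_reticulations hN.connected
    have heq := Set.eq_of_subset_of_ncard_le (s := {a, b}) (t := {v | IsReticulation D (some v)})
      (by rintro v (rfl | rfl) <;> assumption) (by rw [hcard, hr2, Set.ncard_pair hab])
      (Set.toFinite _)
    intro v hv
    have : v ∈ ({a, b} : Set V) := heq ▸ hv
    simpa using this
  -- The apex x is the only reticulation on its triangle, hence its sink: both triangle edges point
  -- into x, up to the subdivision by the root.
  have hsink : ∀ {C : N.Subgraph}, IsCycleOf N C → length C = 3 → ∀ {x x'},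
      x ∈ C.verts → x' ∉ C.verts → (∀ v, IsReticulation D (some v) → v = x ∨ v = x') →
      ∀ u ∈ C.verts, u ≠ x → s(x, u) ≠ f → D.Adj (some u) (some x) := by
    intro C hC h3 x x' hx hx' hr u hu hux hf
    obtain ⟨v, hv, ⟨w, hw⟩, hpv⟩ := hD.exists_sink hC.mem_cycleSpace hC.edgeVector_ne_zero
    have hvC : v ∈ C.verts := mem_verts_of_edgeVector_ne_zero hw
    rcases hr v hv with rfl | rfl
    · exact (hpv _).2 ⟨u, edgeVector_apply_ne_zero.2
        (adj_of_length_eq_three hC h3 hx hu hux.symm), via_of_ne hf⟩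
    · exact absurd hvC hx'
  have hp := hD.2.1.passesTest_iff.2 ht
  have hcommon : ∀ u, u ∈ C₁.verts → u ∈ C₂.verts → s(a, u) = f ∨ s(b, u) = f := by
    intro u hu₁ hu₂
    by_contra! hc
    have hua : u ≠ a := fun h => ha₂ (h ▸ hu₂)
    have hub : u ≠ b := fun h => hb₁ (h ▸ hu₁)
    have h1 := hsink hC₁ h₁ ha₁ hb₁ hret u hu₁ hua hc.1
    have h2 := hsink hC₂ h₂ hb₂ ha₂ (fun v hv => (hret v hv).symm) u hu₂ hub hc.2
    have hout : outdeg D (some u) ≤ 2 := by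
      rcases hD.vertex_types u with h | h | h <;> have := h.2 <;> omega
    have heq := Set.eq_of_subset_of_ncard_le (s := {some a, some b})
      (t := {w | D.Adj (some u) w}) (by rintro v (rfl | rfl) <;> assumption)
      (by rw [Set.ncard_pair (by simpa using hab)]; exact hout) (Set.toFinite _)
    refine hp ⟨some u, ⟨_, h1⟩, fun w hw => ?_⟩
    have hw' : w ∈ ({some a, some b} : Set (Option V)) := heq ▸ hw
    rcases hw' with rfl | rfl <;> assumption
  have h1 := hcommon p hpq₁.fst_mem hpq₂.fst_mem
  have h2 := hcommon q hpq₁.snd_mem hpq₂.snd_mem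
  have hpq := hpq₁.adj_sub.ne
  have hap : a ≠ p := fun h => ha₂ (h ▸ hpq₂.fst_mem)
  have hbp : b ≠ p := fun h => hb₁ (h ▸ hpq₁.fst_mem)
  rcases h1 with h1 | h1 <;> rcases h2 with h2 | h2 <;> rw [← h2, Sym2.eq_iff] at h1 <;> grind

theorem isTreeChildOrientable_iff_of_common_edge (hN : IsUndirectedBinaryNetwork N)
    (hr : cycleRank N ≤ 2) (hC₁ : IsCycleOf N C₁) (hC₂ : IsCycleOf N C₂)
    (h : (C₁.edgeSet ∩ C₂.edgeSet).ncard = 1) :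
    IsTreeChildOrientable N ↔ 4 ≤ length C₁ ∨ 4 ≤ length C₂ := by
  constructor
  · intro ho
    by_contra! hc
    have h1 := hC₁.three_le_length
    have h2 := hC₂.three_le_length
    exact not_isTreeChildOrientable_of_triangles hN hr hC₁ hC₂ h (by omega) (by omega) ho
  · rintro (h4 | h4)
    · exact isTreeChildOrientable_of_four_le hN hr hC₂ hC₁ (by rwa [Set.inter_comm]) h4
    · exact isTreeChildOrientable_of_four_le hN hr hC₁ hC₂ h h4

end CommonEdge

end PhyloOrientation

theorem theorem5 {V : Type*} [Fintype V] (N : SimpleGraph V)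
    (hN : PhyloOrientation.IsUndirectedBinaryNetwork N)
    (hr : PhyloOrientation.cycleRank N ≤ 2) :
    (∃ o, PhyloOrientation.HeuristicReturns N o) ∧
    (∀ o, PhyloOrientation.HeuristicReturns N o → PhyloOrientation.IsTreeChildAnswer N o) ∧
    (∀ C₁ C₂ : N.Subgraph, PhyloOrientation.IsCycleOf N C₁ → PhyloOrientation.IsCycleOf N C₂ →
      (C₁.edgeSet ∩ C₂.edgeSet).ncard = 1 →
      (PhyloOrientation.IsTreeChildOrientable N ↔
        4 ≤ PhyloOrientation.length C₁ ∨ 4 ≤ PhyloOrientation.length C₂)) :=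
  ⟨PhyloOrientation.exists_heuristicReturns hN.connected,
    fun _ ho => ho.isTreeChildAnswer hN hr,
    fun _ _ hC₁ hC₂ h =>
      PhyloOrientation.isTreeChildOrientable_iff_of_common_edge hN hr hC₁ hC₂ h⟩
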